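/- **Conventions.** Let $d\ge 1$. For $x,\xi,t\in\mathbb R^n$ put $T_x\phi(t)=\phi(t-x)$ and $M_\xi\phi(t)=e^{2\pi i t\cdot\xi}\phi(t)$, and for $\phi\in\mathcal S(\mathbb R^n)$, $f\in\mathcal S'(\mathbb R^n)$ let $V_\phi f(x,\xi)=\langle f,M_\xi T_x\phi\rangle$ be the Gabor transform, a function on $\mathbb R^{2n}$ (the bracket is antilinear in the second slot). For a permutation $c$ of $\{1,\dots,2n\}$ put $\mathfrak c(x_1,\dots,x_{2n})=(x_{c(1)},\dots,x_{c(2n)})$. For a real number $s$ let $v_s(z)=(1+|z|)^s$. For $p_1,\dots,p_{2n}\in[1,\infty]$ the mixed modulation space $M(c)_{v_s}^{p_1,\dots,p_{2n}}$ consists of all $f\in\mathcal S'(\mathbb R^n)$ with $$\Big(\int_{\mathbb R}\cdots\Big(\int_{\mathbb R}\big|V_\phi f(\mathfrak c(x))\,v_s(x)\big|^{p_1}\,dx_1\Big)^{p_2/p_1}\cdots\,dx_{2n}\Big)^{1/p_{2n}}<\infty$$ (with the usual modification for infinite exponents) for every nonzero window $\phi\in\mathcal S(\mathbb R^n)$;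 different nonzero windows define the same space. Below $n=2d$. A permutation $c$ of $\{1,\dots,4d\}$ is a *slice permutation* if it maps $\{1,\dots,d\}\cup\{2d+1,\dots,3d\}$ onto $\{1,\dots,2d\}$ (and hence the remaining indices onto $\{2d+1,\dots,4d\}$). The pseudodifferential operator with Kohn–Nirenberg symbol $\tau\in\mathcal S'(\mathbb R^{2d})$ is the operator $K_\tau:\mathcal S(\mathbb R^d)\to\mathcal S'(\mathbb R^d)$, $K_\tau f=\iint\hat\tau(\xi,x)\,M_\xi T_{-x}f\,dx\,d\xi$, understood weakly. It has kernel $k\in\mathcal S'(\mathbb R^{2d})$ if $K_\tau f(t)=\int k(t,y)f(y)\,dy$ weakly, i.e. $(K_\tau f)(g)=k(g\otimes f)$ for all $f,g\in\mathcal S(\mathbb R^d)$, with the bilinear pairing. A linear operator $T$ on $L^2(\mathbb R^d)$ is Schatten $p$-class, $T\in\mathcal I_p(L^2(\mathbb R^d))$, if $\sup\big(\sum_{n}|\langle Tf_n,g_n\rangle|^p\big)^{1/p}<\infty$, the supremum being over all pairs of orthonormal sequences $(f_n)$, $(g_n)$; and $K_\tau\in\mathcal I_p(L^2(\mathbb R^d))$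 means that some such $T$ agrees with $K_\tau$ on $\mathcal S(\mathbb R^d)$. **Theorem.** Let $1\le p\le 2$, $s\le 0$, $p_1,\dots,p_{2d}\in[2,\infty]$, $p_{2d+1},\dots,p_{4d}\in[p,\infty]$, and let $c$ be a slice permutation of $\{1,\dots,4d\}$. Assume that at least one of the following holds: (a) $s<0$; (b) at least one of $p_1,\dots,p_{2d}$ is larger than $2$; (c) at least one of $p_{2d+1},\dots,p_{4d}$ is larger than $p$. Then there is a pseudodifferential operator whose kernel lies in $M(c)_{v_s}^{p_1,\dots,p_{4d}}$ and which is not in $\mathcal I_p(L^2(\mathbb R^d))$, and there is a pseudodifferential operator whose Kohn–Nirenberg symbol lies in $M(c)_{v_s}^{p_1,\dots,p_{4d}}$ and which is not in $\mathcal I_p(L^2(\mathbb R^d))$. -/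

import Mathlib

open MeasureTheory SchwartzMap FourierTransform
open scoped ENNReal RealInnerProductSpace

noncomputable section

namespace MixedModulation

/-- `ℝᵈ` with its Euclidean structure. -/
abbrev RR (d : ℕ) : Type := EuclideanSpace ℝ (Fin d)

/-- The first `n` coordinates of a point of `ℝⁿ⁺ᵐ`. -/
abbrev fstPart {n m : ℕ} : RR (n + m) →L[ℝ] RR n :=
  (ContinuousLinearMap.fst ℝ (RR n) (RR m)).comp
    (EuclideanSpace.finAddEquivProd (𝕜 := ℝ) (n := n) (m := m)).toContinuousLinearMap

/-- The last `m` coordinates of a point of `ℝⁿ⁺ᵐ`. -/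
abbrev sndPart {n m : ℕ} : RR (n + m) →L[ℝ] RR m :=
  (ContinuousLinearMap.snd ℝ (RR n) (RR m)).comp
    (EuclideanSpace.finAddEquivProd (𝕜 := ℝ) (n := n) (m := m)).toContinuousLinearMap

/-! ### Time-frequency shifts -/

/-- The unimodular function `t ↦ e^{2πi q(t)}`. -/
def phase {E : Type*} (q : E → ℝ) (t : E) : ℂ :=
  Complex.exp (((2 * Real.pi * q t : ℝ) : ℂ) * Complex.I)

theorem phase_id_hasTemperateGrowth : (phase (fun t : ℝ => t)).HasTemperateGrowth := by
  have hfun : phase (fun t : ℝ => t)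
      = (fun t : ℝ => Complex.exp ((2 * Real.pi * Complex.I : ℂ) * (t : ℂ))) := by
    funext t
    unfold phase
    congr 1
    push_cast
    ring
  have hder : ∀ n : ℕ, iteratedDeriv n (phase (fun t : ℝ => t))
      = fun t : ℝ => (2 * Real.pi * Complex.I : ℂ) ^ n * phase (fun t : ℝ => t) t := by
    intro n
    induction n with
    | zero => funext t; simp
    | succ n ih =>
      rw [iteratedDeriv_succ, ih]
      funext t
      have h1 : HasDerivAt (phase (fun t : ℝ => t))
          ((2 * Real.pi * Complex.I : ℂ) * phase (fun t : ℝ => t) t) t := by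
        rw [hfun]
        have := ((Complex.ofRealCLM.hasDerivAt (x := t)).const_mul
          (2 * Real.pi * Complex.I : ℂ)).cexp
        simp only [Complex.ofRealCLM_apply, Complex.ofReal_one, mul_one] at this
        convert this using 1
        ring
      rw [(h1.const_mul _).deriv]
      ring
  refine ⟨?_, fun n => ⟨0, (2 * Real.pi) ^ n, fun t => ?_⟩⟩
  · rw [hfun]
    exact (contDiff_const.mul Complex.ofRealCLM.contDiff).cexp
  · rw [norm_iteratedFDeriv_eq_norm_iteratedDeriv, hder]
    simp only [phase, norm_mul, norm_pow, Complex.norm_exp_ofReal_mul_I]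
    simp [abs_of_pos Real.pi_pos]

theorem phase_hasTemperateGrowth {E : Type*} [NormedAddCommGroup E] [NormedSpace ℝ E]
    {q : E → ℝ} (hq : q.HasTemperateGrowth) : (phase q).HasTemperateGrowth :=
  phase_id_hasTemperateGrowth.comp hq

/-- The translation `T_x φ(t) = φ(t - x)`. -/
def translation {n : ℕ} (x : RR n) : 𝓢(RR n, ℂ) →L[ℂ] 𝓢(RR n, ℂ) :=
  SchwartzMap.compSubConstCLM ℂ x

/-- The modulation `M_ξ φ(t) = e^{2πi t·ξ} φ(t)`. -/
def modulation {n : ℕ} (ξ : RR n) : 𝓢(RR n, ℂ) →L[ℂ] 𝓢(RR n, ℂ) :=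
  SchwartzMap.smulLeftCLM ℂ (phase fun t : RR n => ⟪t, ξ⟫)

theorem translation_apply {n : ℕ} (x : RR n) (φ : 𝓢(RR n, ℂ)) (t : RR n) :
    translation x φ t = φ (t - x) := rfl

theorem modulation_apply {n : ℕ} (ξ : RR n) (φ : 𝓢(RR n, ℂ)) (t : RR n) :
    modulation ξ φ t = phase (fun t : RR n => ⟪t, ξ⟫) t * φ t :=
  SchwartzMap.smulLeftCLM_apply_apply
    (phase_hasTemperateGrowth (Function.hasTemperateGrowth_inner_left ξ)) φ t

/-- The complex conjugate of a Schwartz function. -/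
def conjS {n : ℕ} (φ : 𝓢(RR n, ℂ)) : 𝓢(RR n, ℂ) :=
  SchwartzMap.postcompCLM (Complex.conjCLE : ℂ →L[ℝ] ℂ) φ

/-- The Gabor transform `V_φ f(x, ξ) = ⟨f, M_ξ T_x φ⟩`.  The bracket is antilinear in the second
slot, so the distribution `f` acts on the conjugate of `M_ξ T_x φ`. -/
def gaborTransform {n : ℕ} (φ : 𝓢(RR n, ℂ)) (f : 𝓢'(RR n, ℂ)) (x ξ : RR n) : ℂ :=
  f (conjS (modulation ξ (translation x φ)))

/-! ### Mixed norms and mixed modulation spaces -/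

/-- The iterated norm
`(∫ ⋯ (∫ F(x₁, …, x_m)^{p₁} dx₁)^{p₂/p₁} ⋯ dx_m)^{1/p_m}`, with essential suprema for infinite
exponents; the first variable is integrated first. -/
def mixedNorm : (m : ℕ) → (Fin m → ℝ≥0∞) → ((Fin m → ℝ) → ℝ≥0∞) → ℝ≥0∞
  | 0, _, F => F Fin.elim0
  | m + 1, p, F =>
      mixedNorm m (Fin.tail p) fun y => eLpNorm (fun x : ℝ => F (Fin.cons x y)) (p 0) volume

/-- The weight `v_s(z) = (1 + |z|)^s`, with `|z|` the Euclidean norm. -/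
def polyWeight {m : ℕ} (s : ℝ) (z : Fin m → ℝ) : ℝ := (1 + ‖WithLp.toLp 2 z‖) ^ s

/-- `V_φ f` as a function on `ℝ²ⁿ`. -/
def gaborOnPhaseSpace {n : ℕ} (φ : 𝓢(RR n, ℂ)) (f : 𝓢'(RR n, ℂ)) (z : Fin (n + n) → ℝ) : ℂ :=
  gaborTransform φ f (WithLp.toLp 2 fun i => z (Fin.castAdd n i))
    (WithLp.toLp 2 fun i => z (Fin.natAdd n i))

/-- The norm `‖V_φ f ∘ 𝔠‖` in `L_w^{p₁, …, p_{2n}}`, where `𝔠(x) = (x_{c(1)}, …, x_{c(2n)})`. -/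
def mixedModulationNorm {n : ℕ} (φ : 𝓢(RR n, ℂ)) (c : Equiv.Perm (Fin (n + n)))
    (w : (Fin (n + n) → ℝ) → ℝ) (p : Fin (n + n) → ℝ≥0∞) (f : 𝓢'(RR n, ℂ)) : ℝ≥0∞ :=
  mixedNorm (n + n) p fun x => ‖gaborOnPhaseSpace φ f (fun j => x (c j)) * (w x : ℂ)‖ₑ

/-- The mixed modulation space `M(c)_w^{p₁, …, p_{2n}}` computed with the window `φ`. -/
def mixedModulationSpace {n : ℕ} (φ : 𝓢(RR n, ℂ)) (c : Equiv.Perm (Fin (n + n)))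
    (w : (Fin (n + n) → ℝ) → ℝ) (p : Fin (n + n) → ℝ≥0∞) : Set 𝓢'(RR n, ℂ) :=
  {f | mixedModulationNorm φ c w p f < ⊤}

/-- Slice permutations of the `4d` indices (counted from `0`): exactly the positions in
`{0, …, d-1} ∪ {2d, …, 3d-1}` are sent into `{0, …, 2d-1}`. -/
def IsSlicePermutation {d : ℕ} (c : Equiv.Perm (Fin ((d + d) + (d + d)))) : Prop :=
  ∀ j, (c j).val < 2 * d ↔ j.val < d ∨ (2 * d ≤ j.val ∧ j.val < 3 * d)

/-! ### Tensor products of Schwartz functions -/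

theorem tensor_bound {n m : ℕ} (h : 𝓢(RR m, ℂ)) (k N : ℕ) :
    ∃ (s : Finset (ℕ × ℕ)) (C : ℝ), 0 ≤ C ∧ ∀ (g : 𝓢(RR n, ℂ)) (z : RR (n + m)),
      ‖z‖ ^ k * ‖iteratedFDeriv ℝ N (fun z => g (fstPart z) * h (sndPart z)) z‖
        ≤ C * s.sup (schwartzSeminormFamily ℂ (RR n) ℂ) g := by
  set e := EuclideanSpace.finAddEquivProd (𝕜 := ℝ) (n := n) (m := m) with he
  set K : ℝ := ‖(e.symm : RR n × RR m →L[ℝ] RR (n + m))‖ with hK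
  set a : ℝ := ‖(fstPart : RR (n + m) →L[ℝ] RR n)‖ with ha
  set b : ℝ := ‖(sndPart : RR (n + m) →L[ℝ] RR m)‖ with hb
  set S := Finset.Iic (k, N) with hS
  set H : ℝ := 2 ^ k * S.sup (schwartzSeminormFamily ℂ (RR m) ℂ) h with hH
  have hH0 : 0 ≤ H := by positivity
  refine ⟨S, ∑ i ∈ Finset.range (N + 1),
    (N.choose i : ℝ) * (K ^ k * a ^ i * b ^ (N - i) * 2 ^ k * H), by positivity, ?_⟩
  intro g z
  have hz : ‖z‖ ≤ K * ((1 + ‖fstPart z‖) * (1 + ‖sndPart z‖)) := by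
    have h1 : ‖z‖ ≤ K * ‖e z‖ := by
      have := (e.symm : RR n × RR m →L[ℝ] RR (n + m)).le_opNorm (e z)
      simpa using this
    have h2 : ‖e z‖ ≤ (1 + ‖fstPart z‖) * (1 + ‖sndPart z‖) := by
      have e1 : ‖(e z).1‖ = ‖fstPart z‖ := rfl
      have e2 : ‖(e z).2‖ = ‖sndPart z‖ := rfl
      rw [Prod.norm_def, e1, e2]
      have := norm_nonneg (fstPart z)
      have := norm_nonneg (sndPart z)
      apply max_le <;> nlinarith
    exact h1.trans (by gcongr)
  have hcomp1 : ∀ i, ‖iteratedFDeriv ℝ i (fun z => g (fstPart z)) z‖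
      ≤ ‖iteratedFDeriv ℝ i g (fstPart z)‖ * a ^ i := by
    intro i
    have := (fstPart : RR (n + m) →L[ℝ] RR n).iteratedFDeriv_comp_right
      (g.smooth ⊤) z (i := i) (by exact_mod_cast le_top)
    change ‖iteratedFDeriv ℝ i (g ∘ fstPart) z‖ ≤ _
    rw [this]
    refine (ContinuousMultilinearMap.norm_compContinuousLinearMap_le _ _).trans ?_
    simp [ha]
  have hcomp2 : ∀ i, ‖iteratedFDeriv ℝ i (fun z => h (sndPart z)) z‖
      ≤ ‖iteratedFDeriv ℝ i h (sndPart z)‖ * b ^ i := by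
    intro i
    have := (sndPart : RR (n + m) →L[ℝ] RR m).iteratedFDeriv_comp_right
      (h.smooth ⊤) z (i := i) (by exact_mod_cast le_top)
    change ‖iteratedFDeriv ℝ i (h ∘ sndPart) z‖ ≤ _
    rw [this]
    refine (ContinuousMultilinearMap.norm_compContinuousLinearMap_le _ _).trans ?_
    simp [hb]
  have hprod := norm_iteratedFDeriv_mul_le (𝕜 := ℝ) (A := ℂ) (N := (⊤ : ℕ∞))
    (f := fun z : RR (n + m) => g (fstPart z)) (g := fun z => h (sndPart z))
    ((g.smooth ⊤).comp fstPart.contDiff) ((h.smooth ⊤).comp sndPart.contDiff) z (n := N)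
    (by exact_mod_cast le_top)
  calc _ ≤ (K * ((1 + ‖fstPart z‖) * (1 + ‖sndPart z‖))) ^ k
        * ∑ i ∈ Finset.range (N + 1), (N.choose i : ℝ) *
          (‖iteratedFDeriv ℝ i g (fstPart z)‖ * a ^ i) *
          (‖iteratedFDeriv ℝ (N - i) h (sndPart z)‖ * b ^ (N - i)) := by
        gcongr
        refine hprod.trans ?_
        gcongr with i hi
        · exact hcomp1 i
        · exact hcomp2 (N - i)
    _ = ∑ i ∈ Finset.range (N + 1), (N.choose i : ℝ) * (K ^ k * a ^ i * b ^ (N - i) *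
          ((1 + ‖fstPart z‖) ^ k * ‖iteratedFDeriv ℝ i g (fstPart z)‖) *
          ((1 + ‖sndPart z‖) ^ k * ‖iteratedFDeriv ℝ (N - i) h (sndPart z)‖)) := by
        rw [Finset.mul_sum]
        refine Finset.sum_congr rfl fun i _ => ?_
        rw [mul_pow, mul_pow]
        ring
    _ ≤ ∑ i ∈ Finset.range (N + 1), (N.choose i : ℝ) * (K ^ k * a ^ i * b ^ (N - i) *
          (2 ^ k * S.sup (schwartzSeminormFamily ℂ (RR n) ℂ) g) * H) := by
        refine Finset.sum_le_sum fun i hi => ?_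
        have hi' : i ≤ N := Nat.lt_succ_iff.mp (Finset.mem_range.mp hi)
        have b1 : (1 + ‖fstPart z‖) ^ k * ‖iteratedFDeriv ℝ i g (fstPart z)‖
            ≤ 2 ^ k * S.sup (schwartzSeminormFamily ℂ (RR n) ℂ) g :=
          one_add_le_sup_seminorm_apply (𝕜 := ℂ) (m := (k, N)) le_rfl hi' g (fstPart z)
        have b2 : (1 + ‖sndPart z‖) ^ k * ‖iteratedFDeriv ℝ (N - i) h (sndPart z)‖ ≤ H :=
          one_add_le_sup_seminorm_apply (𝕜 := ℂ) (m := (k, N)) le_rfl (Nat.sub_le N i) h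
            (sndPart z)
        refine mul_le_mul_of_nonneg_left (mul_le_mul (mul_le_mul_of_nonneg_left b1 ?_) b2 ?_ ?_) ?_
          <;> positivity
    _ = _ := by
        rw [Finset.sum_mul]
        refine Finset.sum_congr rfl fun i _ => ?_
        ring

/-- The Schwartz function `(g ⊗ h)(t, y) = g(t) h(y)`, as a function of `g`. -/
def tensor {n m : ℕ} (h : 𝓢(RR m, ℂ)) : 𝓢(RR n, ℂ) →L[ℂ] 𝓢(RR (n + m), ℂ) :=
  SchwartzMap.mkCLM (σ := RingHom.id ℂ) (fun g z => g (fstPart z) * h (sndPart z))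
    (fun _ _ _ => by simp [add_mul]) (fun _ _ _ => by simp [mul_assoc])
    (fun g => ((g.smooth ⊤).comp fstPart.contDiff).mul ((h.smooth ⊤).comp sndPart.contDiff))
    (fun n => tensor_bound h n.1 n.2)

theorem tensor_apply {n m : ℕ} (h : 𝓢(RR m, ℂ)) (g : 𝓢(RR n, ℂ)) (z : RR (n + m)) :
    tensor h g z = g (fstPart z) * h (sndPart z) := rfl

/-! ### Pseudodifferential operators -/

/-- The Schwartz function `(ξ, x) ↦ ∫ M_ξ T_{-x} f(t) g(t) dt`, as a function of `g`; see
`shiftPairing_apply`.  It is the inverse Fourier transform of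
`(t, ω) ↦ g(t) f̂(ω) e^{2πi t·ω}`. -/
def shiftPairing {d : ℕ} (f : 𝓢(RR d, ℂ)) : 𝓢(RR d, ℂ) →L[ℂ] 𝓢(RR (d + d), ℂ) :=
  (fourierInvCLM ℂ 𝓢(RR (d + d), ℂ)).comp
    ((SchwartzMap.smulLeftCLM ℂ (phase fun z : RR (d + d) => ⟪fstPart z, sndPart z⟫)).comp
      (tensor (𝓕 f)))

theorem crossPhase_hasTemperateGrowth {d : ℕ} :
    (phase fun z : RR (d + d) => ⟪fstPart z, sndPart z⟫).HasTemperateGrowth :=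
  phase_hasTemperateGrowth ((innerSL ℝ).bilinear_hasTemperateGrowth
    fstPart.hasTemperateGrowth sndPart.hasTemperateGrowth)

theorem volume_preserving_finAddEquivProd {n m : ℕ} :
    MeasurePreserving (EuclideanSpace.finAddEquivProd (𝕜 := ℝ) (n := n) (m := m))
      volume volume :=
  (WithLp.volume_preserving_ofLp (RR n) (RR m)).comp
    ((PiLp.sumPiLpEquivProdLpPiLp 2 _).measurePreserving.comp
      (LinearIsometryEquiv.piLpCongrLeft 2 ℝ ℝ finSumFinEquiv.symm).measurePreserving)

theorem inner_eq_add {n m : ℕ} (z w : RR (n + m)) :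
    ⟪z, w⟫ = ⟪fstPart z, fstPart w⟫ + ⟪sndPart z, sndPart w⟫ := by
  simp only [PiLp.inner_apply, Fin.sum_univ_add]
  rfl

theorem shiftPairing_apply {d : ℕ} (f g : 𝓢(RR d, ℂ)) (z : RR (d + d)) :
    shiftPairing f g z
      = ∫ t : RR d, modulation (fstPart z) (translation (-sndPart z) f) t * g t := by
  set e := EuclideanSpace.finAddEquivProd (𝕜 := ℝ) (n := d) (m := d) with he
  set R : 𝓢(RR (d + d), ℂ) :=
    SchwartzMap.smulLeftCLM ℂ (phase fun z : RR (d + d) => ⟪fstPart z, sndPart z⟫)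
      (tensor (𝓕 f) g) with hR
  have hRa : ∀ w, R w = phase (fun z : RR (d + d) => ⟪fstPart z, sndPart z⟫) w *
      (g (fstPart w) * (𝓕 f) (sndPart w)) := fun w =>
    SchwartzMap.smulLeftCLM_apply_apply crossPhase_hasTemperateGrowth _ w
  let G : RR d × RR d → ℂ := fun q =>
    Complex.exp (((2 * Real.pi * (⟪q.1, fstPart z⟫ + ⟪q.2, sndPart z⟫) : ℝ) : ℂ) * Complex.I) *
      (phase (fun q : RR d × RR d => ⟪q.1, q.2⟫) q * (g q.1 * (𝓕 f) q.2))
  have hG : ∀ w, Complex.exp (((2 * Real.pi * ⟪w, z⟫ : ℝ) : ℂ) * Complex.I) • R w = G (e w) := by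
    intro w
    rw [hRa, inner_eq_add]
    rfl
  have h1 : shiftPairing f g z = ∫ q, G q := by
    change (𝓕⁻ R) z = _
    rw [SchwartzMap.fourierInv_coe, Real.fourierInv_eq']
    simp_rw [hG]
    exact volume_preserving_finAddEquivProd.integral_comp
      e.toHomeomorph.measurableEmbedding G
  have hint : Integrable G := by
    have hb : Integrable (fun q : RR d × RR d => g q.1 * (𝓕 f) q.2) :=
      Integrable.mul_prod g.integrable (𝓕 f).integrable
    have hc : Continuous G := by
      simp only [G, phase]
      fun_prop
    refine hb.norm.mono' hc.aestronglyMeasurable (Filter.Eventually.of_forall fun q => ?_)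
    simp only [G, phase, norm_mul, Complex.norm_exp_ofReal_mul_I, one_mul]
    exact le_rfl
  rw [h1, Measure.volume_eq_prod, integral_prod _ (by simpa [← Measure.volume_eq_prod] using hint)]
  refine integral_congr_ae (Filter.Eventually.of_forall fun t => ?_)
  have hinv : f (t + sndPart z) = ∫ ω : RR d,
      Complex.exp (((2 * Real.pi * ⟪ω, t + sndPart z⟫ : ℝ) : ℂ) * Complex.I) • (𝓕 f) ω := by
    rw [← Real.fourierInv_eq', ← SchwartzMap.fourierInv_coe, FourierTransform.fourierInv_fourier_eq]
  simp only [modulation_apply, translation_apply, sub_neg_eq_add]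
  rw [hinv, mul_assoc, mul_comm _ (g t), ← mul_assoc, ← integral_const_mul]
  refine integral_congr_ae (Filter.Eventually.of_forall fun ω => ?_)
  simp only [G, phase, smul_eq_mul]
  have hexp : Complex.exp
      (((2 * Real.pi * (⟪t, fstPart z⟫ + ⟪ω, sndPart z⟫) : ℝ) : ℂ) * Complex.I) *
      Complex.exp (((2 * Real.pi * ⟪t, ω⟫ : ℝ) : ℂ) * Complex.I) =
      Complex.exp (((2 * Real.pi * ⟪t, fstPart z⟫ : ℝ) : ℂ) * Complex.I) *
      Complex.exp (((2 * Real.pi * ⟪ω, t + sndPart z⟫ : ℝ) : ℂ) * Complex.I) := by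
    rw [← Complex.exp_add, ← Complex.exp_add, inner_add_right, real_inner_comm t ω]
    congr 1
    push_cast
    ring
  linear_combination (g t * (𝓕 f) ω) * hexp

/-- The pseudodifferential operator with Kohn-Nirenberg symbol `τ`,
`K_τ f = ∬ τ̂(ξ, x) M_ξ T_{-x} f dx dξ`, as a linear operator from Schwartz functions to tempered
distributions: the integral is taken weakly, that is,
`(K_τ f)(g) = ∬ τ̂(ξ, x) (∫ M_ξ T_{-x} f(t) g(t) dt) dx dξ` for every Schwartz function `g`, where
`τ̂` is the Fourier transform of the tempered distribution `τ`. -/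
def pseudodiffOp {d : ℕ} (τ : 𝓢'(RR (d + d), ℂ)) : 𝓢(RR d, ℂ) →ₗ[ℂ] 𝓢'(RR d, ℂ) where
  toFun f := PointwiseConvergenceCLM.precomp ℂ (shiftPairing f) (𝓕 τ)
  map_add' f₁ f₂ := by
    ext g
    have : shiftPairing (f₁ + f₂) g = shiftPairing f₁ g + shiftPairing f₂ g := by
      simp only [shiftPairing, ContinuousLinearMap.comp_apply, ← map_add]
      congr 2
      ext z
      simp [tensor_apply, FourierTransform.fourier_add, mul_add]
    change (𝓕 τ) (shiftPairing (f₁ + f₂) g) = (𝓕 τ) (shiftPairing f₁ g) + (𝓕 τ) (shiftPairing f₂ g)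
    rw [this, map_add]
  map_smul' a f := by
    ext g
    have : shiftPairing (a • f) g = a • shiftPairing f g := by
      simp only [shiftPairing, ContinuousLinearMap.comp_apply, ← map_smul]
      congr 2
      ext z
      simp [tensor_apply, FourierTransform.fourier_smul, mul_left_comm]
    change (𝓕 τ) (shiftPairing (a • f) g) = a • (𝓕 τ) (shiftPairing f g)
    rw [this, map_smul]

theorem pseudodiffOp_apply {d : ℕ} (τ : 𝓢'(RR (d + d), ℂ)) (f g : 𝓢(RR d, ℂ)) :
    pseudodiffOp τ f g = (𝓕 τ) (shiftPairing f g) := rfl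

/-- `A` is the integral operator with distributional kernel `k`,
`A f(t) = ∫ k(t, y) f(y) dy`: weakly, `(A f)(g) = ∬ k(t, y) g(t) f(y) dt dy`. -/
def HasKernel {d : ℕ} (A : 𝓢(RR d, ℂ) →ₗ[ℂ] 𝓢'(RR d, ℂ)) (k : 𝓢'(RR (d + d), ℂ)) : Prop :=
  ∀ f g : 𝓢(RR d, ℂ), A f g = k (tensor f g)

/-! ### Schatten classes -/

/-- The Schatten norm: the supremum of `(∑ₙ |⟨A fₙ, gₙ⟩|^p)^{1/p}` over all pairs of orthonormal
sequences `(fₙ)`, `(gₙ)`. -/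
def schattenNorm {H : Type*} [NormedAddCommGroup H] [InnerProductSpace ℂ H] (p : ℝ)
    (A : H →ₗ[ℂ] H) : ℝ≥0∞ :=
  ⨆ (f : ℕ → H) (g : ℕ → H) (_ : Orthonormal ℂ f) (_ : Orthonormal ℂ g),
    (∑' n, ‖inner ℂ (g n) (A (f n))‖ₑ ^ p) ^ (1 / p)

/-- `A` is Schatten `p`-class. -/
def IsSchatten {H : Type*} [NormedAddCommGroup H] [InnerProductSpace ℂ H] (p : ℝ)
    (A : H →ₗ[ℂ] H) : Prop :=
  schattenNorm p A < ⊤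

/-- An operator `A`, given on Schwartz functions with values in tempered distributions, belongs to
the Schatten class `I_p(L²(ℝᵈ))`: some Schatten `p`-class operator on `L²(ℝᵈ)` agrees with `A` on
the (dense) subspace of Schwartz functions. -/
def MemSchatten {d : ℕ} (p : ℝ) (A : 𝓢(RR d, ℂ) →ₗ[ℂ] 𝓢'(RR d, ℂ)) : Prop :=
  ∃ T : Lp ℂ 2 (volume : Measure (RR d)) →ₗ[ℂ] Lp ℂ 2 (volume : Measure (RR d)),
    IsSchatten p T ∧
      ∀ f : 𝓢(RR d, ℂ), Lp.toTemperedDistribution (T (f.toLp 2 volume)) = A f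

end MixedModulation

end

noncomputable section

namespace MixedModulation

/-! ### Time-frequency shifts of Schwartz functions -/

/-! All counterexamples come from one family. Fix Schwartz functions g, f and phase-space points
(μ₁, μ₂), (ν₁, ν₂). Put g_k = M_{kμ₂} T_{kμ₁} g, f_k = M_{kν₂} T_{kν₁} f and a_k = (1+k)^{-α}, with
the g_k orthonormal, and let A u = ∑ a_k (∫ f_k û) g_k. If the f_k are orthonormal and α = 1/p,
suitable orthonormal test sequences give ∑ a_k^p = ∑ 1/(1+k) = ∞. If every f_k is the same
normalized f and α = 1/2, then A sends some Schwartz function to ∑ a_k g_k, which is not in L²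
(`not_memSchatten_of_series`).

The symbol of A is e^{-2πi t·ω} ∑ a_k g_k(t) f_k(ω) and its kernel is ∑ a_k g_k ⊗ f̂_k. Under mild
orthogonality of the points, each is a series of shifts, along a ray kz, of a single Schwartz
function: z = (μ₁, ν₁; μ₂ - ν₁, ν₂ - μ₁) for the symbol, z = (μ₁, ν₂; μ₂, -ν₁) for the kernel. The
Gabor transform is therefore concentrated near the ray, with size at most about (1+k)^{-α} at kz.
Let X be the variable integrated last among the nonzero coordinates of z, and q its exponent. The
other variables see rapidly decaying profiles whose centres move only with X, so what remains is the
L^q norm of (1+|X|)^{s-α}, finite if (α-s)q > 1 (`mem_mixedModulationSpace_of_isWeakSeries`).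

It remains to choose z. For kernels, a ray along one variable of the inner group has constant f_k
and α = 1/2; a ray reaching the outer group has α = 1/p and also an inner coordinate, which a slice
permutation integrates earlier. For symbols, the differences in z allow cancellation: μ₁ = ν₂ = e_i
leaves a single inner coordinate while α = 1/p. As inner exponents are at least 2, this settles p <
2 at once, and only p = 2 needs a case distinction. -/

/-- The time-frequency shift `M_ξ T_x φ`. -/
def tfShift {n : ℕ} (x ξ : RR n) (φ : 𝓢(RR n, ℂ)) : 𝓢(RR n, ℂ) :=
  modulation ξ (translation x φ)

theorem norm_phase {E : Type*} (q : E → ℝ) (t : E) : ‖phase q t‖ = 1 :=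
  Complex.norm_exp_ofReal_mul_I _

theorem phase_mul_phase {E : Type*} (q r : E → ℝ) (t : E) :
    phase q t * phase r t = phase (fun t => q t + r t) t := by
  simp only [phase, ← Complex.exp_add]
  congr 1
  push_cast
  ring

theorem tfShift_apply {n : ℕ} (x ξ : RR n) (φ : 𝓢(RR n, ℂ)) (t : RR n) :
    tfShift x ξ φ t = phase (fun t : RR n => ⟪t, ξ⟫) t * φ (t - x) := by
  rw [tfShift, modulation_apply, translation_apply]

theorem norm_tfShift_apply {n : ℕ} (x ξ : RR n) (φ : 𝓢(RR n, ℂ)) (t : RR n) :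
    ‖tfShift x ξ φ t‖ = ‖φ (t - x)‖ := by
  rw [tfShift_apply, norm_mul, norm_phase, one_mul]

theorem conjS_apply {n : ℕ} (φ : 𝓢(RR n, ℂ)) (t : RR n) :
    conjS φ t = starRingEnd ℂ (φ t) := rfl

theorem fourier_tfShift_apply {n : ℕ} (x ξ : RR n) (φ : 𝓢(RR n, ℂ)) (w : RR n) :
    (𝓕 (tfShift x ξ φ)) w = phase (fun w : RR n => -⟪x, w - ξ⟫) w * (𝓕 φ) (w - ξ) := by
  simp only [SchwartzMap.fourier_coe, Real.fourier_eq']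
  rw [← integral_add_right_eq_self _ x, ← integral_const_mul]
  refine integral_congr_ae (Filter.Eventually.of_forall fun t => ?_)
  simp only [tfShift_apply, add_sub_cancel_right, phase, smul_eq_mul, ← mul_assoc,
    ← Complex.exp_add]
  congr 2
  simp only [inner_add_left, inner_sub_right]
  push_cast
  ring

theorem norm_fourier_tfShift_apply {n : ℕ} (x ξ : RR n) (φ : 𝓢(RR n, ℂ)) (w : RR n) :
    ‖(𝓕 (tfShift x ξ φ)) w‖ = ‖(𝓕 φ) (w - ξ)‖ := by
  rw [fourier_tfShift_apply, norm_mul, norm_phase, one_mul]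

/-- Orthogonality removes the commutation phase e^{2πi x·ξ}, which would otherwise enter the
coefficients of the series. -/
theorem fourier_tfShift {n : ℕ} {x ξ : RR n} (h : ⟪x, ξ⟫ = 0) (φ : 𝓢(RR n, ℂ)) :
    𝓕 (tfShift x ξ φ) = tfShift ξ (-x) (𝓕 φ) := by
  ext w
  rw [fourier_tfShift_apply, tfShift_apply]
  simp only [phase, inner_sub_right, h, inner_neg_right, real_inner_comm x w, sub_zero]

theorem tfShift_tensor {n m : ℕ} (x ξ : RR (n + m)) (g : 𝓢(RR n, ℂ)) (f : 𝓢(RR m, ℂ)) :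
    tfShift x ξ (tensor f g)
      = tensor (tfShift (sndPart x) (sndPart ξ) f) (tfShift (fstPart x) (fstPart ξ) g) := by
  ext z
  rw [tfShift_apply, tensor_apply, tensor_apply, tfShift_apply, tfShift_apply, map_sub fstPart z x,
    map_sub sndPart z x]
  have : phase (fun t : RR (n + m) => ⟪t, ξ⟫) z
      = phase (fun t => ⟪t, fstPart ξ⟫) (fstPart z) * phase (fun t => ⟪t, sndPart ξ⟫) (sndPart z) := by
    simp only [phase, ← Complex.exp_add]
    congr 1
    rw [inner_eq_add]
    push_cast
    ring
  rw [this]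
  ring

theorem integral_tensor_mul_tensor {n m : ℕ} (g g' : 𝓢(RR n, ℂ)) (f f' : 𝓢(RR m, ℂ)) :
    ∫ z, tensor f g z * tensor f' g' z = (∫ t, g t * g' t) * ∫ t, f t * f' t := by
  rw [← integral_prod_mul (μ := volume) (ν := volume), ← Measure.volume_eq_prod,
    ← volume_preserving_finAddEquivProd.integral_comp
      (EuclideanSpace.finAddEquivProd (𝕜 := ℝ)).toHomeomorph.measurableEmbedding]
  refine integral_congr_ae (Filter.Eventually.of_forall fun z => ?_)
  simp only [tensor_apply]
  exact mul_mul_mul_comm _ _ _ _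

/-! ### Decay of correlations of time-frequency shifts -/

/-- Peetre's inequality 1+|x-y| ≤ (1+|t-x|)(1+|t-y|) distributes the weight over the two factors
under the integral. Only moduli enter, so the estimate serves time-frequency shifts and their
Fourier transforms alike. -/
theorem one_add_norm_pow_mul_norm_integral_le {n : ℕ} (N : ℕ) (Φ : 𝓢(RR n, ℂ))
    {u v : RR n → ℂ} {x y : RR n} {B : ℝ} (hu : ∀ t, ‖u t‖ ≤ ‖Φ (t - x)‖)
    (hv : ∀ t, (1 + ‖t - y‖) ^ N * ‖v t‖ ≤ B) :
    (1 + ‖x - y‖) ^ N * ‖∫ t, u t * v t‖ ≤ B * ∫ t, (1 + ‖t‖) ^ N * ‖Φ t‖ := by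
  have hint : Integrable fun t => (1 + ‖t‖) ^ N * ‖Φ t‖ := by
    have h1 : Integrable fun t => 2 ^ N * (‖Φ t‖ + ‖t‖ ^ N * ‖Φ t‖) :=
      (Φ.integrable.norm.add (Φ.integrable_pow_mul volume N)).const_mul _
    refine h1.mono' (by fun_prop) (Filter.Eventually.of_forall fun t => ?_)
    rw [Real.norm_of_nonneg (by positivity)]
    have h2 : (1 + ‖t‖) ^ N ≤ 2 ^ N * (1 + ‖t‖ ^ N) := by
      rcases le_total ‖t‖ 1 with h | h
      · calc (1 + ‖t‖) ^ N ≤ (2 : ℝ) ^ N := by gcongr; linarith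
          _ ≤ _ := le_mul_of_one_le_right (by positivity) (by simp)
      · calc (1 + ‖t‖) ^ N ≤ (2 * ‖t‖) ^ N := by gcongr; linarith
          _ = 2 ^ N * ‖t‖ ^ N := mul_pow _ _ _
          _ ≤ _ := by gcongr; linarith
    calc _ ≤ 2 ^ N * (1 + ‖t‖ ^ N) * ‖Φ t‖ := by gcongr
      _ = _ := by ring
  have hshift : ∫ t, (1 + ‖t - x‖) ^ N * ‖Φ (t - x)‖ = ∫ t, (1 + ‖t‖) ^ N * ‖Φ t‖ :=
    integral_sub_right_eq_self (fun t => (1 + ‖t‖) ^ N * ‖Φ t‖) x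
  rw [← hshift, ← integral_const_mul]
  have e : (1 + ‖x - y‖) ^ N * ‖∫ t, u t * v t‖
      = ‖∫ t, ((1 + ‖x - y‖) ^ N : ℝ) • (u t * v t)‖ := by
    rw [integral_smul, norm_smul, Real.norm_of_nonneg (by positivity)]
  rw [e]
  refine norm_integral_le_of_norm_le ((hint.comp_sub_right x).const_mul B)
    (Filter.Eventually.of_forall fun t => ?_)
  rw [norm_smul, Real.norm_of_nonneg (by positivity), norm_mul]
  have hxy : (1 + ‖x - y‖) ^ N ≤ (1 + ‖t - x‖) ^ N * (1 + ‖t - y‖) ^ N := by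
    rw [← mul_pow]
    gcongr
    have : ‖x - y‖ ≤ ‖t - x‖ + ‖t - y‖ := by
      have := norm_sub_le (t - y) (t - x)
      rw [sub_sub_sub_cancel_left] at this
      linarith
    nlinarith [norm_nonneg (t - x), norm_nonneg (t - y)]
  calc _ ≤ ((1 + ‖t - x‖) ^ N * (1 + ‖t - y‖) ^ N) * (‖Φ (t - x)‖ * ‖v t‖) := by
        gcongr
        exact hu t
    _ = ((1 + ‖t - y‖) ^ N * ‖v t‖) * ((1 + ‖t - x‖) ^ N * ‖Φ (t - x)‖) := by ring
    _ ≤ B * ((1 + ‖t - x‖) ^ N * ‖Φ (t - x)‖) := by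
        gcongr
        exact hv t

theorem one_add_norm_pow_mul_norm_le {n : ℕ} (N : ℕ) (φ : 𝓢(RR n, ℂ)) (t : RR n) :
    (1 + ‖t‖) ^ N * ‖φ t‖
      ≤ 2 ^ N * (Finset.Iic (N, 0)).sup (schwartzSeminormFamily ℂ (RR n) ℂ) φ := by
  have := one_add_le_sup_seminorm_apply (𝕜 := ℂ) (m := (N, 0)) le_rfl le_rfl φ t
  rwa [norm_iteratedFDeriv_zero] at this

theorem integral_mul_conj_fourier {n : ℕ} (f g : 𝓢(RR n, ℂ)) :
    ∫ t, (𝓕 f) t * conjS (𝓕 g) t = ∫ t, f t * conjS g t := by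
  have := SchwartzMap.integral_inner_fourier_fourier g f
  simpa [conjS_apply, RCLike.inner_apply] using this

/-- Decay in x-y is visible on the time side, decay in ξ-η on the Fourier side by Parseval;
whichever distance is larger decides the side. -/
theorem exists_correlation_bound {n : ℕ} (N : ℕ) (Φ φ : 𝓢(RR n, ℂ)) :
    ∃ C : ℝ, 0 ≤ C ∧ ∀ x ξ y η : RR n,
      ‖∫ t, tfShift x ξ Φ t * conjS (tfShift y η φ) t‖
        ≤ C * ((1 + max ‖x - y‖ ‖ξ - η‖) ^ N)⁻¹ := by
  set A : 𝓢(RR n, ℂ) → 𝓢(RR n, ℂ) → ℝ := fun φ Φ =>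
    2 ^ N * (Finset.Iic (N, 0)).sup (schwartzSeminormFamily ℂ (RR n) ℂ) φ *
      ∫ t, (1 + ‖t‖) ^ N * ‖Φ t‖ with hA
  have hA0 : ∀ φ Φ, 0 ≤ A φ Φ := fun φ Φ =>
    mul_nonneg (mul_nonneg (by positivity) (apply_nonneg _ _))
      (integral_nonneg fun t => by positivity)
  refine ⟨max (A φ Φ) (A (𝓕 φ) (𝓕 Φ)), le_max_of_le_left (hA0 _ _), fun x ξ y η => ?_⟩
  rw [← div_eq_mul_inv, le_div_iff₀ (by positivity), mul_comm]
  rcases max_cases ‖x - y‖ ‖ξ - η‖ with ⟨h, -⟩ | ⟨h, -⟩ <;> rw [h]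
  · refine le_max_of_le_left ?_
    refine one_add_norm_pow_mul_norm_integral_le N Φ (fun t => (norm_tfShift_apply ..).le)
      fun t => ?_
    rw [conjS_apply, RCLike.norm_conj, norm_tfShift_apply]
    exact one_add_norm_pow_mul_norm_le N φ (t - y)
  · refine le_max_of_le_right ?_
    rw [← integral_mul_conj_fourier]
    refine one_add_norm_pow_mul_norm_integral_le N (𝓕 Φ)
      (fun t => (norm_fourier_tfShift_apply ..).le) fun t => ?_
    rw [conjS_apply, RCLike.norm_conj, norm_fourier_tfShift_apply]
    exact one_add_norm_pow_mul_norm_le N (𝓕 φ) (t - η)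

/-! ### Series of time-frequency shifts -/

/-- `T = ∑ₙ aₙ Φₙ`, with convergence against every Schwartz function. -/
def IsWeakSeries {n : ℕ} (a : ℕ → ℂ) (Φ : ℕ → 𝓢(RR n, ℂ)) (T : 𝓢'(RR n, ℂ)) : Prop :=
  ∀ ψ : 𝓢(RR n, ℂ), HasSum (fun k => a k * ∫ t, Φ k t * ψ t) (T ψ)

theorem IsWeakSeries.precomp {n : ℕ} {a : ℕ → ℂ} {Φ Ψ : ℕ → 𝓢(RR n, ℂ)} {T : 𝓢'(RR n, ℂ)}
    (hT : IsWeakSeries a Φ T) (L : 𝓢(RR n, ℂ) →L[ℂ] 𝓢(RR n, ℂ))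
    (hL : ∀ k ψ, ∫ t, Φ k t * L ψ t = ∫ t, Ψ k t * ψ t) :
    IsWeakSeries a Ψ (PointwiseConvergenceCLM.precomp ℂ L T) := by
  intro ψ
  simp_rw [← hL]
  exact hT (L ψ)

theorem exists_isWeakSeries_of_summable {n : ℕ} {a : ℕ → ℂ} (ha : ∀ k, ‖a k‖ ≤ 1)
    {Φ : ℕ → 𝓢(RR n, ℂ)} {b : ℕ → ℝ} (hb : Summable b) {s : Finset (ℕ × ℕ)}
    (h : ∀ k (ψ : 𝓢(RR n, ℂ)), ‖∫ t, Φ k t * ψ t‖ ≤ s.sup (schwartzSeminormFamily ℂ (RR n) ℂ) ψ * b k) :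
    ∃ T, IsWeakSeries a Φ T := by
  have hbound : ∀ (ψ : 𝓢(RR n, ℂ)) k, ‖a k * ∫ t, Φ k t * ψ t‖
      ≤ s.sup (schwartzSeminormFamily ℂ (RR n) ℂ) ψ * b k := fun ψ k => by
    rw [norm_mul]
    exact (mul_le_of_le_one_left (norm_nonneg _) (ha k)).trans (h k ψ)
  have hsum : ∀ ψ : 𝓢(RR n, ℂ), Summable fun k => a k * ∫ t, Φ k t * ψ t := fun ψ =>
    .of_norm_bounded (hb.mul_left _) (hbound ψ)
  have hint : ∀ k (ψ : 𝓢(RR n, ℂ)), Integrable fun t => Φ k t * ψ t := fun k ψ =>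
    (SchwartzMap.pairing (ContinuousLinearMap.mul ℂ ℂ) (Φ k) ψ).integrable
  let T : 𝓢(RR n, ℂ) →L[ℂ] ℂ := SchwartzMap.mkCLMtoNormedSpace (σ := RingHom.id ℂ)
    (fun ψ => ∑' k, a k * ∫ t, Φ k t * ψ t)
    (fun ψ χ => by
      rw [← (hsum ψ).tsum_add (hsum χ)]
      refine tsum_congr fun k => ?_
      rw [← mul_add, ← integral_add (hint k ψ) (hint k χ)]
      simp [mul_add])
    (fun c ψ => by
      rw [RingHom.id_apply, smul_eq_mul, ← tsum_mul_left]
      refine tsum_congr fun k => ?_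
      have e : ∀ t, Φ k t * (c • ψ) t = c * (Φ k t * ψ t) := fun t => by simp [mul_left_comm]
      simp_rw [e]
      rw [integral_const_mul, mul_left_comm])
    ⟨s, |∑' k, b k|, abs_nonneg _, fun ψ => by
      refine (tsum_of_norm_bounded (hb.mul_left _).hasSum (hbound ψ)).trans ?_
      rw [tsum_mul_left, mul_comm]
      exact mul_le_mul_of_nonneg_right (le_abs_self _) (apply_nonneg _ _)⟩
  exact ⟨ContinuousLinearMap.toPointwiseConvergenceCLM ℂ _ _ _ T, fun ψ => (hsum ψ).hasSum⟩

theorem exists_isWeakSeries_of_norm_le {n : ℕ} {a : ℕ → ℂ} (ha : ∀ k, ‖a k‖ ≤ 1)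
    {Φ : ℕ → 𝓢(RR n, ℂ)} (Φ₀ : 𝓢(RR n, ℂ)) {x : RR n} (hx : x ≠ 0)
    (h : ∀ (k : ℕ) t, ‖Φ k t‖ ≤ ‖Φ₀ (t - (k : ℝ) • x)‖) :
    ∃ T, IsWeakSeries a Φ T := by
  have hx0 : 0 < ‖x‖ := norm_pos_iff.2 hx
  -- In Lean the inverse of 0² is 0, so the term k = 0 needs its own summand.
  have hb : Summable fun k : ℕ =>
      (2 ^ 2 * ∫ t, (1 + ‖t‖) ^ 2 * ‖Φ₀ t‖) * (‖x‖⁻¹ ^ 2 * ((k : ℝ) ^ 2)⁻¹ +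
        if k = 0 then 1 else 0) :=
    ((((Real.summable_nat_pow_inv (p := 2)).2 one_lt_two).mul_left _).add
      (summable_of_hasFiniteSupport ((Set.finite_singleton 0).subset
        fun k hk => by by_contra h0; simp_all))).mul_left _
  refine exists_isWeakSeries_of_summable ha hb (s := Finset.Iic (2, 0)) fun k ψ => ?_
  have key := one_add_norm_pow_mul_norm_integral_le 2 Φ₀ (v := ψ) (y := 0) (h k)
    fun t => by simpa using one_add_norm_pow_mul_norm_le 2 ψ t
  rw [mul_comm, ← le_div_iff₀ (by positivity)] at key
  refine key.trans ?_
  rw [div_eq_mul_inv, mul_right_comm (2 ^ 2 : ℝ), mul_comm (2 ^ 2 * _ : ℝ), mul_assoc]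
  refine mul_le_mul_of_nonneg_left (mul_le_mul_of_nonneg_left ?_ ?_) (apply_nonneg _ _)
  · rcases eq_or_ne k 0 with rfl | hk
    · simp
    · have hk' : (0 : ℝ) < k := by positivity
      simp only [hk, if_false, add_zero, sub_zero, ← inv_pow, ← mul_pow, ← mul_inv]
      gcongr
      rw [norm_smul, Real.norm_of_nonneg hk'.le, mul_comm]
      linarith
  · exact mul_nonneg (by positivity) (integral_nonneg fun t => by positivity)

/-- Translates that move off to infinity pair summably with a Schwartz function. For pure
modulations the Fourier transform reduces to that case. -/
theorem exists_isWeakSeries_tfShift {n : ℕ} {a : ℕ → ℂ} (ha : ∀ k, ‖a k‖ ≤ 1)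
    (Φ : 𝓢(RR n, ℂ)) {x ξ : RR n} (h : x ≠ 0 ∨ ξ ≠ 0) :
    ∃ T, IsWeakSeries a (fun k => tfShift ((k : ℝ) • x) ((k : ℝ) • ξ) Φ) T := by
  by_cases hx : x = 0
  · have hξ : ξ ≠ 0 := by simpa [hx] using h
    obtain ⟨T, hT⟩ := exists_isWeakSeries_of_norm_le ha (𝓕⁻ Φ) (neg_ne_zero.2 hξ)
      (Φ := fun k => tfShift ((k : ℝ) • -ξ) 0 (𝓕⁻ Φ)) fun k t => (norm_tfShift_apply ..).le
    refine ⟨_, hT.precomp (fourierCLM ℂ 𝓢(RR n, ℂ)) fun k ψ => ?_⟩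
    rw [fourierCLM_apply, ← SchwartzMap.integral_fourier_mul_eq,
      fourier_tfShift (inner_zero_right _), FourierTransform.fourier_fourierInv_eq, hx, smul_zero,
      smul_neg, neg_neg]
  · exact exists_isWeakSeries_of_norm_le ha Φ hx fun k t => (norm_tfShift_apply ..).le

/-! ### Finiteness of mixed norms -/

/-- A function dominated by a product of one-variable functions, each of which may be translated by
an amount depending on the later variables, has finite mixed norm. -/
theorem mixedNorm_lt_top_of_le_prod : ∀ (m : ℕ) (p : Fin m → ℝ≥0∞) (h : Fin m → ℝ → ℝ≥0∞)
    (_ : ∀ i, Measurable (h i)) (_ : ∀ i, eLpNorm (h i) (p i) volume < ⊤)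
    (b : Fin m → (Fin m → ℝ) → ℝ)
    (_ : ∀ i x y, (∀ k, i < k → x k = y k) → b i x = b i y)
    (C : ℝ≥0∞) (_ : C < ⊤) (F : (Fin m → ℝ) → ℝ≥0∞)
    (_ : ∀ x, F x ≤ C * ∏ i, h i (x i - b i x)), mixedNorm m p F < ⊤
  | 0, p, h, _, _, b, _, C, hC, F, hF => by
    refine (hF Fin.elim0).trans_lt ?_
    simpa using hC
  | m + 1, p, h, hm, hfin, b, hb, C, hC, F, hF => by
    -- No shift depends on the first coordinate, so 0 is an arbitrary filler there. By translation
    -- invariance the innermost norm is a constant, which joins C.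
    refine mixedNorm_lt_top_of_le_prod m (Fin.tail p) (fun i => h i.succ) (fun i => hm _)
      (fun i => hfin _) (fun i y => b i.succ (Fin.cons 0 y)) (fun i x y hxy => hb _ _ _ fun k hk => ?_)
      (C * eLpNorm (h 0) (p 0) volume) (ENNReal.mul_lt_top hC (hfin 0)) _ fun y => ?_
    · obtain ⟨k, rfl⟩ := Fin.exists_succ_eq.2 (Fin.ne_zero_of_lt hk)
      simpa using hxy k (Fin.succ_lt_succ_iff.1 hk)
    · have hmp : MeasurePreserving (fun x : ℝ => x - b 0 (Fin.cons 0 y)) volume volume :=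
        measurePreserving_sub_right volume _
      have hbd := eLpNorm_le_mul_eLpNorm_of_ae_le_mul'' (μ := volume)
        (f := fun x : ℝ => F (Fin.cons x y))
        (g := fun x : ℝ => h 0 (x - b 0 (Fin.cons 0 y)))
        (c := C * ∏ i : Fin m, h i.succ (y i - b i.succ (Fin.cons 0 y))) (p 0)
        ((hm 0).comp hmp.measurable).aestronglyMeasurable
        (Filter.Eventually.of_forall fun x => by
          have := hF (Fin.cons x y)
          rw [Fin.prod_univ_succ] at this
          simp only [enorm_eq_self]
          refine this.trans (le_of_eq ?_)
          have e0 : b 0 (Fin.cons x y) = b 0 (Fin.cons 0 y) := hb _ _ _ fun k hk => by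
            obtain ⟨k, rfl⟩ := Fin.exists_succ_eq.2 (Fin.ne_zero_of_lt hk)
            simp
          have e1 : ∀ i : Fin m, b i.succ (Fin.cons x y) = b i.succ (Fin.cons 0 y) := fun i =>
            hb _ _ _ fun k hk => by
              obtain ⟨k, rfl⟩ := Fin.exists_succ_eq.2 (Fin.ne_zero_of_lt hk)
              simp
          simp only [Fin.cons_zero, Fin.cons_succ, e0, e1]
          ring)
      have hinv : eLpNorm (fun x : ℝ => h 0 (x - b 0 (Fin.cons 0 y))) (p 0) volume
          = eLpNorm (h 0) (p 0) volume :=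
        eLpNorm_comp_measurePreserving (hm 0).aestronglyMeasurable hmp
      rw [hinv] at hbd
      exact hbd.trans (le_of_eq (by ring))

theorem eLpNorm_one_add_abs_rpow_lt_top {r : ℝ} (hr : 0 ≤ r) {p : ℝ≥0∞} (hp0 : p ≠ 0)
    (h : p ≠ ⊤ → 1 < r * p.toReal) :
    eLpNorm (fun x : ℝ => ENNReal.ofReal ((1 + |x|) ^ (-r))) p volume < ⊤ := by
  by_cases hp : p = ⊤
  · subst hp
    refine lt_of_le_of_lt (eLpNormEssSup_le_of_ae_enorm_bound (C := 1)
      (Filter.Eventually.of_forall fun x => ?_)) ENNReal.one_lt_top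
    rw [enorm_eq_self, ENNReal.ofReal_le_one]
    exact Real.rpow_le_one_of_one_le_of_nonpos (by linarith [abs_nonneg x]) (by linarith)
  · rw [eLpNorm_lt_top_iff_lintegral_rpow_enorm_lt_top hp0 hp]
    have hint := integrable_one_add_norm (E := ℝ) (μ := volume) (r := r * p.toReal)
      (by simpa using h hp)
    have := hint.lintegral_lt_top
    refine lt_of_le_of_lt (lintegral_mono fun x => ?_) this
    have hx : 0 ≤ 1 + |x| := by positivity
    rw [enorm_eq_self, ENNReal.ofReal_rpow_of_nonneg (by positivity) ENNReal.toReal_nonneg,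
      ← Real.rpow_mul hx, Real.norm_eq_abs, neg_mul]

/-! ### Lattice sums -/

/-- Recentring at the integer part of εx compares the sum with a fixed sum over ℤ, at the cost of a
factor 4; hence the bound is uniform in x. -/
theorem exists_tsum_one_add_abs_sub_le :
    ∃ A : ℝ≥0∞, A < ⊤ ∧ ∀ x ε : ℝ, |ε| = 1 →
      ∑' n : ℕ, ENNReal.ofReal (((1 + |x - ε * n|) ^ 2)⁻¹) ≤ A := by
  have hsum : Summable fun k : ℤ => 4 * ((1 + |(k : ℝ)|) ^ 2)⁻¹ := by
    refine Summable.mul_left _ (Summable.of_nat_of_neg ?_ ?_) <;>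
    · have := (summable_nat_add_iff 1).2 ((Real.summable_nat_pow_inv (p := 2)).2 one_lt_two)
      refine this.congr fun n => ?_
      push_cast
      simp [abs_of_nonneg, add_comm]
  refine ⟨∑' k : ℤ, ENNReal.ofReal (4 * ((1 + |(k : ℝ)|) ^ 2)⁻¹), ?_, fun x ε hε => ?_⟩
  · rw [← ENNReal.ofReal_tsum_of_nonneg (fun k => by positivity) hsum]
    exact ENNReal.ofReal_lt_top
  · have hinj : Function.Injective fun n : ℕ => (n : ℤ) - ⌊ε * x⌋ := fun m n h => by
      simpa using h
    refine le_trans (ENNReal.tsum_le_tsum fun n => ?_) (ENNReal.tsum_comp_le_tsum_of_injective hinj _)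
    refine ENNReal.ofReal_le_ofReal ?_
    have hεε : ε * ε = 1 := by rw [← abs_mul_abs_self, hε, one_mul]
    have e : |x - ε * n| = |ε * x - n| := by
      rw [← one_mul |x - ε * n|, ← hε, ← abs_mul, mul_sub, ← mul_assoc, hεε, one_mul]
    have h1 : |((n : ℝ) - ⌊ε * x⌋)| ≤ |ε * x - n| + 1 := by
      have h0 := Int.floor_le (ε * x)
      have h2 := Int.lt_floor_add_one (ε * x)
      rw [abs_le]
      constructor <;> linarith [neg_abs_le (ε * x - n), le_abs_self (ε * x - n)]
    push_cast
    rw [e, inv_le_comm₀ (by positivity) (by positivity), mul_inv, inv_inv]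
    have h3 : 1 + |((n : ℝ) - ⌊ε * x⌋)| ≤ 2 * (1 + |ε * x - n|) := by
      linarith [abs_nonneg (ε * x - n)]
    have := pow_le_pow_left₀ (by positivity) h3 2
    rw [mul_pow] at this
    linarith

/-! ### Membership in mixed modulation spaces -/

/-- Budget for the exponent 2·card + 3, with R the distance to the n-th point of the ray: two powers
for each remaining variable, one to replace n by |X| in the coefficient (this uses α ≤ 1), and two
for the sum over n. -/
theorem one_add_rpow_mul_inv_pow_le {ι : Type*} (s : Finset ι) {α R X ε : ℝ} (n : ℕ)
    (hα0 : 0 ≤ α) (hα1 : α ≤ 1) (hε : |ε| = 1) (hX : |X - ε * n| ≤ R)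
    {y : ι → ℝ} (hy : ∀ i ∈ s, |y i| ≤ 2 * R) :
    (1 + n : ℝ) ^ (-α) * ((1 + R) ^ (2 * s.card + 3))⁻¹
      ≤ 4 ^ s.card * (1 + |X|) ^ (-α) * (∏ i ∈ s, (1 + |y i|) ^ (-2 : ℝ)) *
        ((1 + |X - ε * n|) ^ 2)⁻¹ := by
  have hR : 0 ≤ R := (abs_nonneg _).trans hX
  have h1 : (1 + n : ℝ) ^ (-α) ≤ (1 + |X|) ^ (-α) * (1 + R) := by
    have hXn : 1 + |X| ≤ (1 + n) * (1 + R) := by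
      have : |X| ≤ |X - ε * n| + n := by
        have := abs_add_le (X - ε * n) (ε * n)
        rw [sub_add_cancel, abs_mul, hε, one_mul, Nat.abs_cast] at this
        exact this
      have hn : (0 : ℝ) ≤ n := n.cast_nonneg
      nlinarith
    have h2 : (1 + |X|) ^ α ≤ (1 + n : ℝ) ^ α * (1 + R) := by
      calc (1 + |X|) ^ α ≤ ((1 + n) * (1 + R)) ^ α := by gcongr
        _ = (1 + n : ℝ) ^ α * (1 + R) ^ α := Real.mul_rpow (by positivity) (by positivity)
        _ ≤ (1 + n : ℝ) ^ α * (1 + R) ^ (1 : ℝ) := by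
          gcongr
          linarith
        _ = _ := by rw [Real.rpow_one]
    rw [Real.rpow_neg (by positivity), Real.rpow_neg (by positivity), inv_mul_eq_div,
      le_div_iff₀ (by positivity), inv_mul_le_iff₀ (by positivity)]
    exact h2
  have h2 : ((1 + R) ^ (2 * s.card))⁻¹ ≤ 4 ^ s.card * ∏ i ∈ s, (1 + |y i|) ^ (-2 : ℝ) := by
    rw [← Finset.prod_const, ← Finset.prod_mul_distrib, pow_mul, ← inv_pow, ← Finset.prod_const]
    refine Finset.prod_le_prod (fun i _ => by positivity) fun i hi => ?_
    rw [Real.rpow_neg (by positivity), Real.rpow_two, inv_le_comm₀ (by positivity) (by positivity),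
      mul_inv, inv_inv]
    have h3 : 1 + |y i| ≤ 2 * (1 + R) := by linarith [hy i hi]
    have := pow_le_pow_left₀ (by positivity) h3 2
    rw [mul_pow] at this
    linarith
  have h3 : ((1 + R) ^ 2)⁻¹ ≤ ((1 + |X - ε * n|) ^ 2)⁻¹ := by gcongr
  calc (1 + n : ℝ) ^ (-α) * ((1 + R) ^ (2 * s.card + 3))⁻¹
      ≤ ((1 + |X|) ^ (-α) * (1 + R)) * ((1 + R) ^ (2 * s.card + 3))⁻¹ := by gcongr
    _ = (1 + |X|) ^ (-α) * ((1 + R) ^ (2 * s.card))⁻¹ * ((1 + R) ^ 2)⁻¹ := by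
      field_simp
      ring
    _ ≤ (1 + |X|) ^ (-α) * (4 ^ s.card * ∏ i ∈ s, (1 + |y i|) ^ (-2 : ℝ)) *
        ((1 + |X - ε * n|) ^ 2)⁻¹ := by gcongr
    _ = _ := by ring

/-- The point `(x, ξ)` of phase space as a function of its `2n` coordinates. -/
def phasePoint {n : ℕ} (x ξ : RR n) : Fin (n + n) → ℝ := Fin.append x ξ

theorem abs_phasePoint_le {n : ℕ} (x ξ : RR n) (i : Fin (n + n)) :
    |phasePoint x ξ i| ≤ max ‖x‖ ‖ξ‖ := by
  refine Fin.addCases (fun i => ?_) (fun i => ?_) i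
  · rw [phasePoint, Fin.append_left]
    exact le_max_of_le_left (PiLp.norm_apply_le x i)
  · rw [phasePoint, Fin.append_right]
    exact le_max_of_le_right (PiLp.norm_apply_le ξ i)

theorem mem_mixedModulationSpace_of_isWeakSeries {n : ℕ} {a : ℕ → ℂ} {α s : ℝ} (hα0 : 0 ≤ α)
    (hα1 : α ≤ 1) (hs : s ≤ 0) (ha : ∀ k : ℕ, ‖a k‖ ≤ (1 + k : ℝ) ^ (-α))
    {Φ : 𝓢(RR n, ℂ)} {x ξ : RR n} {τ : 𝓢'(RR n, ℂ)}
    (hτ : IsWeakSeries a (fun k => tfShift ((k : ℝ) • x) ((k : ℝ) • ξ) Φ) τ)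
    (P : Fin (n + n) → ℝ≥0∞) (hP : ∀ i, 1 ≤ P i) (c : Equiv.Perm (Fin (n + n)))
    {j : Fin (n + n)} (hj : |phasePoint x ξ j| = 1) (hle : ∀ i, |phasePoint x ξ i| ≤ 1)
    (hlt : ∀ i, i ≠ j → phasePoint x ξ i ≠ 0 → c i < c j)
    (hPj : P (c j) ≠ ⊤ → 1 < (α - s) * (P (c j)).toReal) (φ : 𝓢(RR n, ℂ)) :
    τ ∈ mixedModulationSpace φ c (polyWeight s) P := by
  obtain ⟨A, hA, hAsum⟩ := exists_tsum_one_add_abs_sub_le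
  set S : Finset (Fin (n + n)) := Finset.univ.erase (c j) with hS
  obtain ⟨C, hC, hcorr⟩ := exists_correlation_bound (2 * S.card + 3) Φ φ
  set ε := phasePoint x ξ j with hε
  have hεε : ε * ε = 1 := by rw [← abs_mul_abs_self, hj, one_mul]
  -- The ray has parameter k = εX as ε = ±1, so its other coordinates are the multiples z_i ε of X.
  -- The slope at c j is set to 0 because X itself is not recentred. All decay available in X is α -
  -- s; elsewhere exponent 2 suffices for every P i ≥ 1.
  let l : Fin (n + n) → ℝ := fun i => if i = c j then 0 else phasePoint x ξ (c.symm i) * ε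
  let r : Fin (n + n) → ℝ := fun i => if i = c j then α - s else 2
  refine mixedNorm_lt_top_of_le_prod (n + n) P (fun i t => ENNReal.ofReal ((1 + |t|) ^ (-r i)))
    (fun i => by fun_prop) (fun i => ?_) (fun i y => l i * y (c j)) (fun i y z hyz => ?_)
    (ENNReal.ofReal (C * 4 ^ S.card) * A) (ENNReal.mul_lt_top ENNReal.ofReal_lt_top hA) _
    fun y => ?_
  · by_cases hi : i = c j
    · refine eLpNorm_one_add_abs_rpow_lt_top ?_ (zero_lt_one.trans_le (hP i)).ne' ?_
      · simp only [r, hi, if_true]; linarith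
      · simpa only [r, hi, if_true] using hPj
    · refine eLpNorm_one_add_abs_rpow_lt_top ?_ (zero_lt_one.trans_le (hP i)).ne' fun htop => ?_
      · simp [r, hi]
      · simp only [r, hi, if_false]
        have := ENNReal.toReal_mono htop (hP i)
        rw [ENNReal.toReal_one] at this
        linarith
  · by_cases hi : i = c j
    · simp [l, hi]
    · by_cases h0 : phasePoint x ξ (c.symm i) = 0
      · simp [l, h0]
      -- A variable with nonzero slope is integrated before X, so its shift depends on later
      -- variables only.
      · have := hlt (c.symm i) (fun h => hi (by rw [← h, Equiv.apply_symm_apply])) h0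
        rw [Equiv.apply_symm_apply] at this
        simp only [hyz _ this]
  · set X := y (c j) with hX
    set w : RR n := WithLp.toLp 2 fun i => y (c (Fin.castAdd n i)) with hw
    set η : RR n := WithLp.toLp 2 fun i => y (c (Fin.natAdd n i)) with hη
    have hcoord : ∀ (k : ℕ) i, |y (c i) - phasePoint x ξ i * k|
        ≤ max ‖(k : ℝ) • x - w‖ ‖(k : ℝ) • ξ - η‖ := by
      intro k i
      refine le_trans (le_of_eq ?_) (abs_phasePoint_le ((k : ℝ) • x - w) ((k : ℝ) • ξ - η) i)
      rw [abs_sub_comm]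
      congr 1
      refine Fin.addCases (fun i => ?_) (fun i => ?_) i
      · simp only [phasePoint, Fin.append_left]
        simp [hw, mul_comm]
      · simp only [phasePoint, Fin.append_right]
        simp [hη, mul_comm]
    set Y : Fin (n + n) → ℝ := fun i => y i - l i * X with hY
    have hYb : ∀ (k : ℕ), ∀ i ∈ S, |Y i| ≤ 2 * max ‖(k : ℝ) • x - w‖ ‖(k : ℝ) • ξ - η‖ := by
      intro k i hi
      have hi' : i ≠ c j := Finset.ne_of_mem_erase hi
      have h1 := hcoord k (c.symm i)
      have h2 := hcoord k j
      rw [Equiv.apply_symm_apply] at h1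
      -- Each of the two terms is at most the distance to the k-th point of the ray, whence the
      -- factor 2.
      have e : Y i = (y i - phasePoint x ξ (c.symm i) * k)
          - phasePoint x ξ (c.symm i) * ε * (X - ε * k) := by
        simp only [hY, l, hi', if_false]
        linear_combination (-(k : ℝ) * phasePoint x ξ (c.symm i)) * hεε
      rw [e]
      refine (abs_sub _ _).trans ?_
      rw [abs_mul, abs_mul, hj, mul_one]
      have := mul_le_of_le_one_left (abs_nonneg (X - ε * k)) (hle (c.symm i))
      linarith
    have hterm : ∀ k : ℕ, ‖a k * ∫ t, tfShift ((k : ℝ) • x) ((k : ℝ) • ξ) Φ t *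
        conjS (tfShift w η φ) t‖ₑ
        ≤ ENNReal.ofReal (C * 4 ^ S.card * (1 + |X|) ^ (-α) * ∏ i ∈ S, (1 + |Y i|) ^ (-2 : ℝ)) *
          ENNReal.ofReal (((1 + |X - ε * k|) ^ 2)⁻¹) := by
      intro k
      rw [← ENNReal.ofReal_mul (by positivity), ← ofReal_norm, norm_mul]
      refine ENNReal.ofReal_le_ofReal ?_
      calc _ ≤ (1 + k : ℝ) ^ (-α) * (C * ((1 + max ‖(k : ℝ) • x - w‖ ‖(k : ℝ) • ξ - η‖) ^
              (2 * S.card + 3))⁻¹) := by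
            gcongr
            · exact ha k
            · exact hcorr _ _ _ _
        _ = C * ((1 + k : ℝ) ^ (-α) * ((1 + max ‖(k : ℝ) • x - w‖ ‖(k : ℝ) • ξ - η‖) ^
              (2 * S.card + 3))⁻¹) := by ring
        _ ≤ C * (4 ^ S.card * (1 + |X|) ^ (-α) * (∏ i ∈ S, (1 + |Y i|) ^ (-2 : ℝ)) *
              ((1 + |X - ε * k|) ^ 2)⁻¹) := by
            exact mul_le_mul_of_nonneg_left
              (one_add_rpow_mul_inv_pow_le S k hα0 hα1 hj (hcoord k j) (hYb k)) hC
        _ = _ := by ring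
    have hV : ‖gaborOnPhaseSpace φ τ fun i => y (c i)‖ₑ
        ≤ ENNReal.ofReal (C * 4 ^ S.card * (1 + |X|) ^ (-α) * ∏ i ∈ S, (1 + |Y i|) ^ (-2 : ℝ)) *
          A := by
      have hg : gaborOnPhaseSpace φ τ (fun i => y (c i)) = τ (conjS (tfShift w η φ)) := rfl
      rw [hg, ← (hτ _).tsum_eq]
      refine enorm_tsum_le_tsum_enorm.trans ?_
      refine (ENNReal.tsum_le_tsum hterm).trans ?_
      rw [ENNReal.tsum_mul_left]
      gcongr
      exact hAsum X ε hj
    have hwt : ‖((polyWeight s y : ℝ) : ℂ)‖ₑ ≤ ENNReal.ofReal ((1 + |X|) ^ s) := by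
      rw [← ofReal_norm, Complex.norm_real, polyWeight, Real.norm_of_nonneg (by positivity)]
      refine ENNReal.ofReal_le_ofReal (Real.rpow_le_rpow_of_nonpos (by positivity) ?_ hs)
      gcongr
      exact PiLp.norm_apply_le (WithLp.toLp 2 y) (c j)
    rw [enorm_mul]
    refine (mul_le_mul' hV hwt).trans (le_of_eq ?_)
    rw [← ENNReal.ofReal_prod_of_nonneg (fun i _ => by positivity),
      ← Finset.mul_prod_erase _ _ (Finset.mem_univ (c j))]
    have hprod : ∏ i ∈ Finset.univ.erase (c j), (1 + |y i - l i * X|) ^ (-r i)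
        = ∏ i ∈ S, (1 + |Y i|) ^ (-2 : ℝ) :=
      Finset.prod_congr rfl fun i hi => by
        simp only [r, Finset.ne_of_mem_erase hi, if_false, hY]
    have hjj : (1 + |y (c j) - l (c j) * X|) ^ (-r (c j)) = (1 + |X|) ^ (-α) * (1 + |X|) ^ s := by
      rw [← Real.rpow_add (by positivity)]
      simp only [r, l, if_true, zero_mul, sub_zero, hX]
      congr 1
      ring
    rw [hprod, hjj, mul_right_comm, mul_right_comm _ A, ← ENNReal.ofReal_mul (by positivity),
      ← ENNReal.ofReal_mul (by positivity)]
    congr 2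
    ring

/-! ### Orthonormal families of Schwartz functions -/

theorem inner_toLp_toLp {n : ℕ} (f g : 𝓢(RR n, ℂ)) :
    inner ℂ (f.toLp 2 volume) (g.toLp 2 volume) = ∫ t, g t * conjS f t := by
  rw [SchwartzMap.inner_toL2_toL2_eq f g volume]
  simp [conjS_apply, RCLike.inner_apply]

theorem orthonormal_toLp_iff {n : ℕ} {f : ℕ → 𝓢(RR n, ℂ)} :
    Orthonormal ℂ (fun k => (f k).toLp 2 volume)
      ↔ ∀ i j, ∫ t, f j t * conjS (f i) t = if i = j then 1 else 0 := by
  simp_rw [orthonormal_iff_ite, inner_toLp_toLp]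

theorem orthonormal_toLp_conjS {n : ℕ} {f : ℕ → 𝓢(RR n, ℂ)}
    (hf : Orthonormal ℂ fun k => (f k).toLp 2 volume) :
    Orthonormal ℂ fun k => (conjS (f k)).toLp 2 volume := by
  rw [orthonormal_toLp_iff] at hf ⊢
  intro i j
  simp_rw [eq_comm (a := i), ← hf j i]
  refine integral_congr_ae (Filter.Eventually.of_forall fun t => ?_)
  simp [conjS_apply, mul_comm]

theorem orthonormal_toLp_fourier_iff {n : ℕ} {f : ℕ → 𝓢(RR n, ℂ)} :
    Orthonormal ℂ (fun k => (𝓕 (f k)).toLp 2 volume)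
      ↔ Orthonormal ℂ fun k => (f k).toLp 2 volume := by
  simp_rw [orthonormal_iff_ite, SchwartzMap.inner_fourier_toL2_eq]

/-- A normalized bump of radius 1/4: its translates by distinct integer multiples of a unit vector
have disjoint supports. -/
theorem exists_orthonormal_translations {d : ℕ} (i : Fin d) :
    ∃ b : 𝓢(RR d, ℂ), Orthonormal ℂ fun k : ℕ =>
      (tfShift ((k : ℝ) • EuclideanSpace.single i (1 : ℝ)) 0 b).toLp 2 volume := by
  let β : ContDiffBump (0 : RR d) := ⟨1 / 8, 1 / 4, by norm_num, by norm_num⟩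
  have hcs : HasCompactSupport fun t : RR d => ((β t : ℝ) : ℂ) :=
    β.hasCompactSupport.comp_left Complex.ofReal_zero
  let b₀ : 𝓢(RR d, ℂ) := hcs.toSchwartzMap (Complex.ofRealCLM.contDiff.comp β.contDiff)
  have hb₀ : ∀ t, b₀ t = ((β t : ℝ) : ℂ) := fun t => rfl
  have hne : b₀.toLp 2 volume ≠ 0 := by
    intro h
    have h0 : b₀ = 0 :=
      SchwartzMap.injective_toLp 2 volume (h.trans (map_zero (toLpCLM ℂ ℂ 2 volume)).symm)
    have h1 : b₀ 0 = 1 := by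
      rw [hb₀, β.one_of_mem_closedBall (by simp [β])]
      simp
    rw [h0] at h1
    simp at h1
  have hself : ∫ t, b₀ t * conjS b₀ t = ((‖b₀.toLp 2 volume‖ ^ 2 : ℝ) : ℂ) := by
    rw [← inner_toLp_toLp, inner_self_eq_norm_sq_to_K]
    norm_cast
  set r : ℝ := ‖b₀.toLp 2 volume‖ with hr
  have hr0 : r ≠ 0 := norm_ne_zero_iff.2 hne
  refine ⟨((r⁻¹ : ℝ) : ℂ) • b₀, orthonormal_toLp_iff.2 fun k l => ?_⟩
  have hphase : ∀ t : RR d, phase (fun t : RR d => ⟪t, (0 : RR d)⟫) t = 1 := fun t => by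
    simp [phase]
  simp only [conjS_apply, tfShift_apply, hphase, one_mul]
  split_ifs with hkl
  · subst hkl
    rw [integral_sub_right_eq_self (fun t => (((r⁻¹ : ℝ) : ℂ) • b₀) t *
      starRingEnd ℂ ((((r⁻¹ : ℝ) : ℂ) • b₀) t))]
    have : ∀ t, (((r⁻¹ : ℝ) : ℂ) • b₀) t * starRingEnd ℂ ((((r⁻¹ : ℝ) : ℂ) • b₀) t)
        = ((r⁻¹ ^ 2 : ℝ) : ℂ) * (b₀ t * conjS b₀ t) := fun t => by
      simp only [_root_.smul_apply, smul_eq_mul, map_mul, Complex.conj_ofReal, conjS_apply]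
      push_cast
      ring
    simp_rw [this]
    rw [integral_const_mul, hself, ← Complex.ofReal_mul, ← mul_pow, inv_mul_cancel₀ hr0]
    simp
  · refine integral_eq_zero_of_ae (Filter.Eventually.of_forall fun t => ?_)
    have hz : ∀ t, 1 / 4 ≤ ‖t‖ → b₀ t = 0 := fun t ht => by
      rw [hb₀, β.zero_of_le_dist (by simpa [β] using ht), Complex.ofReal_zero]
    have hcase : 1 / 4 ≤ ‖t - (l : ℝ) • EuclideanSpace.single i (1 : ℝ)‖ ∨
        1 / 4 ≤ ‖t - (k : ℝ) • EuclideanSpace.single i (1 : ℝ)‖ := by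
      by_contra! hlt
      have h1 := norm_sub_le (t - (l : ℝ) • EuclideanSpace.single i (1 : ℝ))
        (t - (k : ℝ) • EuclideanSpace.single i (1 : ℝ))
      rw [sub_sub_sub_cancel_left, ← sub_smul, norm_smul, PiLp.norm_single,
        norm_one, mul_one, Real.norm_eq_abs] at h1
      have h2 : (1 : ℝ) ≤ |(k : ℝ) - l| := by
        have h3 : (1 : ℤ) ≤ |(k : ℤ) - l| := Int.one_le_abs (by omega)
        exact_mod_cast h3
      linarith [hlt.1, hlt.2]
    rcases hcase with h | h <;> simp [hz _ h]

theorem exists_orthonormal_modulations {d : ℕ} (i : Fin d) :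
    ∃ b : 𝓢(RR d, ℂ), Orthonormal ℂ fun k : ℕ =>
      (tfShift 0 ((k : ℝ) • EuclideanSpace.single i (1 : ℝ)) b).toLp 2 volume := by
  obtain ⟨b, hb⟩ := exists_orthonormal_translations i
  refine ⟨𝓕⁻ b, orthonormal_toLp_fourier_iff.1 ?_⟩
  simpa only [fourier_tfShift (inner_zero_left _), neg_zero,
    FourierTransform.fourier_fourierInv_eq] using hb

/-! ### Operators outside the Schatten classes -/

theorem inner_toLp_eq_toTemperedDistribution {d : ℕ} (g : 𝓢(RR d, ℂ))
    (u : Lp ℂ 2 (volume : Measure (RR d))) :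
    inner ℂ (g.toLp 2 volume) u = Lp.toTemperedDistribution u (conjS g) := by
  rw [Lp.toTemperedDistribution_apply, L2.inner_def]
  refine integral_congr_ae ?_
  filter_upwards [g.coeFn_toLp 2 volume] with t ht
  rw [ht, RCLike.inner_apply, conjS_apply, smul_eq_mul, mul_comm]

theorem not_memSchatten_of_tsum_eq_top {d : ℕ} {p : ℝ} (hp : 0 < p)
    {A : 𝓢(RR d, ℂ) →ₗ[ℂ] 𝓢'(RR d, ℂ)} {f g : ℕ → 𝓢(RR d, ℂ)}
    (hf : Orthonormal ℂ fun k => (f k).toLp 2 volume)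
    (hg : Orthonormal ℂ fun k => (g k).toLp 2 volume)
    (h : ∑' k, ‖A (f k) (conjS (g k))‖ₑ ^ p = ⊤) : ¬ MemSchatten p A := by
  rintro ⟨T, hT, hTA⟩
  refine hT.not_ge ?_
  have hle : (∑' k, ‖inner ℂ ((g k).toLp 2 volume) (T ((f k).toLp 2 volume))‖ₑ ^ p) ^ (1 / p)
      ≤ schattenNorm p T :=
    le_iSup₂_of_le (fun k => (f k).toLp 2 volume) (fun k => (g k).toLp 2 volume)
      (le_iSup₂_of_le hf hg le_rfl)
  simp_rw [inner_toLp_eq_toTemperedDistribution, hTA, h] at hle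
  rwa [ENNReal.top_rpow_of_pos (by positivity)] at hle

/-- Bessel's inequality for the single vector T f of L²; no boundedness of T enters. -/
theorem not_memSchatten_of_not_summable {d : ℕ} {p : ℝ}
    {A : 𝓢(RR d, ℂ) →ₗ[ℂ] 𝓢'(RR d, ℂ)} (f : 𝓢(RR d, ℂ)) {g : ℕ → 𝓢(RR d, ℂ)}
    (hg : Orthonormal ℂ fun k => (g k).toLp 2 volume)
    (h : ¬ Summable fun k => ‖A f (conjS (g k))‖ ^ 2) : ¬ MemSchatten p A := by
  rintro ⟨T, -, hTA⟩
  refine h ?_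
  have := hg.inner_products_summable (x := T (f.toLp 2 volume))
  simpa only [inner_toLp_eq_toTemperedDistribution, hTA] using this

/-! ### Pairs of points and coordinates of phase space -/

/-- The point `(u, v)` of `ℝⁿ⁺ᵐ`. -/
def joinPts {n m : ℕ} (u : RR n) (v : RR m) : RR (n + m) := WithLp.toLp 2 (Fin.append u v)

theorem joinPts_castAdd {n m : ℕ} (u : RR n) (v : RR m) (i : Fin n) :
    joinPts u v (Fin.castAdd m i) = u i := Fin.append_left _ _ i

theorem joinPts_natAdd {n m : ℕ} (u : RR n) (v : RR m) (i : Fin m) :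
    joinPts u v (Fin.natAdd n i) = v i := Fin.append_right _ _ i

theorem fstPart_joinPts {n m : ℕ} (u : RR n) (v : RR m) : fstPart (joinPts u v) = u := by
  ext i
  exact joinPts_castAdd u v i

theorem sndPart_joinPts {n m : ℕ} (u : RR n) (v : RR m) : sndPart (joinPts u v) = v := by
  ext i
  exact joinPts_natAdd u v i

/-- The index of the `i`-th coordinate of the first half of the time variables. -/
abbrev timeFst {d : ℕ} (i : Fin d) : Fin ((d + d) + (d + d)) := Fin.castAdd _ (Fin.castAdd _ i)

/-- The index of the `i`-th coordinate of the second half of the time variables. -/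
abbrev timeSnd {d : ℕ} (i : Fin d) : Fin ((d + d) + (d + d)) := Fin.castAdd _ (Fin.natAdd _ i)

/-- The index of the `i`-th coordinate of the first half of the frequency variables. -/
abbrev freqFst {d : ℕ} (i : Fin d) : Fin ((d + d) + (d + d)) := Fin.natAdd _ (Fin.castAdd _ i)

/-- The index of the `i`-th coordinate of the second half of the frequency variables. -/
abbrev freqSnd {d : ℕ} (i : Fin d) : Fin ((d + d) + (d + d)) := Fin.natAdd _ (Fin.natAdd _ i)

theorem forall_phaseIndex {d : ℕ} {Q : Fin ((d + d) + (d + d)) → Prop}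
    (h₁ : ∀ i, Q (timeFst i)) (h₂ : ∀ i, Q (timeSnd i)) (h₃ : ∀ i, Q (freqFst i))
    (h₄ : ∀ i, Q (freqSnd i)) (j) : Q j :=
  Fin.addCases (fun j => Fin.addCases h₁ h₂ j) (fun j => Fin.addCases h₃ h₄ j) j

section PhasePoint

variable {d : ℕ} (u v w z : RR d) (i : Fin d)

theorem phasePoint_timeFst : phasePoint (joinPts u v) (joinPts w z) (timeFst i) = u i := by
  rw [phasePoint, Fin.append_left, joinPts_castAdd]

theorem phasePoint_timeSnd : phasePoint (joinPts u v) (joinPts w z) (timeSnd i) = v i := by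
  rw [phasePoint, Fin.append_left, joinPts_natAdd]

theorem phasePoint_freqFst : phasePoint (joinPts u v) (joinPts w z) (freqFst i) = w i := by
  rw [phasePoint, Fin.append_right, joinPts_castAdd]

theorem phasePoint_freqSnd : phasePoint (joinPts u v) (joinPts w z) (freqSnd i) = z i := by
  rw [phasePoint, Fin.append_right, joinPts_natAdd]

end PhasePoint

theorem IsSlicePermutation.timeFst_lt {d : ℕ} {c : Equiv.Perm (Fin ((d + d) + (d + d)))}
    (hc : IsSlicePermutation c) (i : Fin d) : (c (timeFst i)).val < 2 * d :=
  (hc _).2 (Or.inl i.2)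

theorem IsSlicePermutation.freqFst_lt {d : ℕ} {c : Equiv.Perm (Fin ((d + d) + (d + d)))}
    (hc : IsSlicePermutation c) (i : Fin d) : (c (freqFst i)).val < 2 * d := by
  refine (hc _).2 (Or.inr ?_)
  simp only [Fin.val_natAdd, Fin.val_castAdd]
  omega

theorem IsSlicePermutation.le_timeSnd {d : ℕ} {c : Equiv.Perm (Fin ((d + d) + (d + d)))}
    (hc : IsSlicePermutation c) (i : Fin d) : 2 * d ≤ (c (timeSnd i)).val := by
  rw [← not_lt, hc]
  simp only [Fin.val_natAdd, Fin.val_castAdd]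
  omega

theorem IsSlicePermutation.le_freqSnd {d : ℕ} {c : Equiv.Perm (Fin ((d + d) + (d + d)))}
    (hc : IsSlicePermutation c) (i : Fin d) : 2 * d ≤ (c (freqSnd i)).val := by
  rw [← not_lt, hc]
  simp only [Fin.val_natAdd]
  omega

/-! ### Symbols and kernels given by series -/

/-- Multiplication of a Schwartz function of `(t, ω)` by `e^{-2πi t·ω}`. -/
def dechirp {d : ℕ} : 𝓢(RR (d + d), ℂ) →L[ℂ] 𝓢(RR (d + d), ℂ) :=
  SchwartzMap.smulLeftCLM ℂ (phase fun z : RR (d + d) => -⟪fstPart z, sndPart z⟫)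

theorem dechirp_apply {d : ℕ} (ψ : 𝓢(RR (d + d), ℂ)) (z : RR (d + d)) :
    dechirp ψ z = phase (fun z : RR (d + d) => -⟪fstPart z, sndPart z⟫) z * ψ z :=
  SchwartzMap.smulLeftCLM_apply_apply (phase_hasTemperateGrowth
    ((innerSL ℝ).bilinear_hasTemperateGrowth fstPart.hasTemperateGrowth
      sndPart.hasTemperateGrowth).neg) ψ z

/-- Multiplication by a chirp shears phase space: moving the point by (m₁, n₁) changes the frequency
by (-n₁, -m₁). Orthogonality kills the constant phase. -/
theorem tfShift_dechirp {d : ℕ} {m₁ m₂ n₁ n₂ : RR d} (h : ⟪m₁, n₁⟫ = 0)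
    (ψ : 𝓢(RR (d + d), ℂ)) :
    tfShift (joinPts m₁ n₁) (joinPts (m₂ - n₁) (n₂ - m₁)) (dechirp ψ)
      = dechirp (tfShift (joinPts m₁ n₁) (joinPts m₂ n₂) ψ) := by
  ext z
  rw [tfShift_apply, dechirp_apply, dechirp_apply, tfShift_apply, ← mul_assoc, ← mul_assoc]
  congr 1
  simp only [phase, ← Complex.exp_add]
  congr 1
  rw [inner_eq_add, inner_eq_add z (joinPts m₂ n₂), map_sub, map_sub]
  simp only [fstPart_joinPts, sndPart_joinPts, inner_sub_left, inner_sub_right, h,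
    real_inner_comm (sndPart z) m₁]
  push_cast
  ring

/-- The Fourier transform of the symbol undoes the inverse transform in `shiftPairing`, and the two
opposite chirps cancel. -/
theorem pseudodiffOp_precomp_dechirp {d : ℕ} (K : 𝓢'(RR (d + d), ℂ)) (u v : 𝓢(RR d, ℂ)) :
    pseudodiffOp (PointwiseConvergenceCLM.precomp ℂ dechirp K) u v = K (tensor (𝓕 u) v) := by
  have h : dechirp (SchwartzMap.smulLeftCLM ℂ
      (phase fun z : RR (d + d) => ⟪fstPart z, sndPart z⟫) (tensor (𝓕 u) v))
      = tensor (𝓕 u) v := by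
    ext z
    rw [dechirp_apply, SchwartzMap.smulLeftCLM_apply_apply crossPhase_hasTemperateGrowth,
      smul_eq_mul, ← mul_assoc, phase_mul_phase]
    simp [phase]
  rw [pseudodiffOp_apply, TemperedDistribution.fourier_apply]
  change K (dechirp (𝓕 (𝓕⁻ (SchwartzMap.smulLeftCLM ℂ
    (phase fun z : RR (d + d) => ⟪fstPart z, sndPart z⟫) (tensor (𝓕 u) v))))) = _
  rw [FourierTransform.fourier_fourierInv_eq]
  exact congrArg K h

theorem joinPts_ne_zero {n m : ℕ} {u : RR n} (hu : u ≠ 0) (v : RR m) : joinPts u v ≠ 0 :=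
  fun h => hu (by rw [← fstPart_joinPts u v, h, map_zero])

theorem smul_joinPts {n m : ℕ} (r : ℝ) (u : RR n) (v : RR m) :
    r • joinPts u v = joinPts (r • u) (r • v) := by
  ext i
  refine Fin.addCases (fun i => ?_) (fun i => ?_) i
  · simp [joinPts_castAdd]
  · simp [joinPts_natAdd]

theorem integral_tfShift_tensor_mul_tensor {d : ℕ} (r : ℝ) (μ₁ μ₂ ν₁ ν₂ : RR d)
    (g f u v : 𝓢(RR d, ℂ)) :
    ∫ z, tfShift (r • joinPts μ₁ ν₁) (r • joinPts μ₂ ν₂) (tensor f g) z * tensor u v z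
      = (∫ t, tfShift (r • μ₁) (r • μ₂) g t * v t) * ∫ t, tfShift (r • ν₁) (r • ν₂) f t * u t := by
  simp only [smul_joinPts, tfShift_tensor, fstPart_joinPts, sndPart_joinPts,
    integral_tensor_mul_tensor]

theorem exists_symbol_of_series {d : ℕ} {a : ℕ → ℂ} (ha : ∀ k, ‖a k‖ ≤ 1)
    {μ₁ μ₂ ν₁ ν₂ : RR d} (hμ : μ₁ ≠ 0 ∨ μ₂ ≠ 0) (hμν : ⟪μ₁, ν₁⟫ = 0) (g f : 𝓢(RR d, ℂ)) :
    ∃ τ : 𝓢'(RR (d + d), ℂ),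
      (∀ u v, HasSum (fun k : ℕ => a k *
        ((∫ t, tfShift ((k : ℝ) • μ₁) ((k : ℝ) • μ₂) g t * v t) *
          ∫ t, tfShift ((k : ℝ) • ν₁) ((k : ℝ) • ν₂) f t * (𝓕 u) t)) (pseudodiffOp τ u v)) ∧
      IsWeakSeries a (fun k : ℕ => tfShift ((k : ℝ) • joinPts μ₁ ν₁)
        ((k : ℝ) • joinPts (μ₂ - ν₁) (ν₂ - μ₁)) (dechirp (tensor f g))) τ := by
  obtain ⟨K, hK⟩ := exists_isWeakSeries_tfShift ha (tensor f g)
    (hμ.imp (joinPts_ne_zero · ν₁) (joinPts_ne_zero · ν₂))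
  refine ⟨PointwiseConvergenceCLM.precomp ℂ dechirp K, fun u v => ?_,
    hK.precomp dechirp fun k ψ => ?_⟩
  · rw [pseudodiffOp_precomp_dechirp]
    simpa only [integral_tfShift_tensor_mul_tensor] using hK (tensor (𝓕 u) v)
  · simp only [smul_joinPts, smul_sub]
    rw [tfShift_dechirp (by rw [real_inner_smul_left, real_inner_smul_right, hμν]; simp)]
    refine integral_congr_ae (Filter.Eventually.of_forall fun z => ?_)
    simp only [dechirp_apply]
    ring

/-- Moving the Fourier transform from u to f by ∫ f û = ∫ f̂ u turns the shift (ν₁, ν₂) into (ν₂,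
-ν₁). -/
theorem exists_kernel_of_series {d : ℕ} {a : ℕ → ℂ} (ha : ∀ k, ‖a k‖ ≤ 1)
    {μ₁ μ₂ ν₁ ν₂ : RR d} (hμ : μ₁ ≠ 0 ∨ μ₂ ≠ 0) (hν : ⟪ν₁, ν₂⟫ = 0) {g f : 𝓢(RR d, ℂ)}
    {A : 𝓢(RR d, ℂ) →ₗ[ℂ] 𝓢'(RR d, ℂ)}
    (hA : ∀ u v, HasSum (fun k : ℕ => a k *
        ((∫ t, tfShift ((k : ℝ) • μ₁) ((k : ℝ) • μ₂) g t * v t) *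
          ∫ t, tfShift ((k : ℝ) • ν₁) ((k : ℝ) • ν₂) f t * (𝓕 u) t)) (A u v)) :
    ∃ κ : 𝓢'(RR (d + d), ℂ), HasKernel A κ ∧
      IsWeakSeries a (fun k : ℕ => tfShift ((k : ℝ) • joinPts μ₁ ν₂)
        ((k : ℝ) • joinPts μ₂ (-ν₁)) (tensor (𝓕 f) g)) κ := by
  obtain ⟨κ, hκ⟩ := exists_isWeakSeries_tfShift ha (tensor (𝓕 f) g)
    (hμ.imp (joinPts_ne_zero · ν₂) (joinPts_ne_zero · (-ν₁)))
  refine ⟨κ, fun u v => (hA u v).unique ?_, hκ⟩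
  refine (hκ (tensor u v)).congr_fun fun k => ?_
  rw [integral_tfShift_tensor_mul_tensor, ← SchwartzMap.integral_fourier_mul_eq, fourier_tfShift
    (by rw [real_inner_smul_left, real_inner_smul_right, hν]; simp), smul_neg]

/-! ### Coefficients -/

/-- The coefficients `(1 + k)^{-α}`. -/
def decayCoeff (α : ℝ) (k : ℕ) : ℂ := (((1 + k : ℝ) ^ (-α) : ℝ) : ℂ)

theorem norm_decayCoeff (α : ℝ) (k : ℕ) : ‖decayCoeff α k‖ = (1 + k : ℝ) ^ (-α) := by
  rw [decayCoeff, Complex.norm_real, Real.norm_of_nonneg (by positivity)]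

theorem norm_decayCoeff_le_one {α : ℝ} (hα : 0 ≤ α) (k : ℕ) : ‖decayCoeff α k‖ ≤ 1 := by
  rw [norm_decayCoeff]
  exact Real.rpow_le_one_of_one_le_of_nonpos (by linarith [(k.cast_nonneg : (0 : ℝ) ≤ k)])
    (by linarith)

theorem norm_decayCoeff_rpow {p : ℝ} (hp : 0 < p) (k : ℕ) :
    ‖decayCoeff (1 / p) k‖ ^ p = (1 + k : ℝ)⁻¹ := by
  rw [norm_decayCoeff, ← Real.rpow_mul (by positivity), neg_mul, one_div_mul_cancel hp.ne',
    Real.rpow_neg_one]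

theorem not_summable_one_add_inv : ¬ Summable fun k : ℕ => (1 + k : ℝ)⁻¹ := by
  intro h
  refine Real.not_summable_natCast_inv ((summable_nat_add_iff 1).1 (h.congr fun k => ?_))
  push_cast
  rw [add_comm]

theorem tsum_enorm_decayCoeff_rpow {p : ℝ} (hp : 0 < p) :
    ∑' k, ‖decayCoeff (1 / p) k‖ₑ ^ p = ⊤ := by
  by_contra h
  refine not_summable_one_add_inv ((ENNReal.summable_toReal h).congr fun k => ?_)
  rw [← ENNReal.toReal_rpow, toReal_enorm, norm_decayCoeff_rpow hp]

/-! ### Examples outside the Schatten class -/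

/-- The second factors `M_{kν₂} T_{kν₁} f` are orthonormal, and the coefficients are not
`p`-summable; or they are all equal to one normalized function, and the coefficients are not
square summable. -/
def IsCritical {d : ℕ} (p α : ℝ) (ν₁ ν₂ : RR d) (f : 𝓢(RR d, ℂ)) : Prop :=
  (α = 1 / p ∧ Orthonormal ℂ fun k : ℕ =>
    (tfShift ((k : ℝ) • ν₁) ((k : ℝ) • ν₂) f).toLp 2 volume) ∨
  (α = 1 / 2 ∧ ∀ k : ℕ, ∫ t, tfShift ((k : ℝ) • ν₁) ((k : ℝ) • ν₂) f t * conjS f t = 1)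

theorem not_memSchatten_of_series {d : ℕ} {p α : ℝ} (hp : 0 < p) {μ₁ μ₂ ν₁ ν₂ : RR d}
    {g f : 𝓢(RR d, ℂ)} {A : 𝓢(RR d, ℂ) →ₗ[ℂ] 𝓢'(RR d, ℂ)}
    (hA : ∀ u v, HasSum (fun k : ℕ => decayCoeff α k *
        ((∫ t, tfShift ((k : ℝ) • μ₁) ((k : ℝ) • μ₂) g t * v t) *
          ∫ t, tfShift ((k : ℝ) • ν₁) ((k : ℝ) • ν₂) f t * (𝓕 u) t)) (A u v))
    (hg : Orthonormal ℂ fun k : ℕ =>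
      (tfShift ((k : ℝ) • μ₁) ((k : ℝ) • μ₂) g).toLp 2 volume)
    (hf : IsCritical p α ν₁ ν₂ f) : ¬ MemSchatten p A := by
  have hg' := orthonormal_toLp_iff.1 hg
  rcases hf with ⟨rfl, hf⟩ | ⟨rfl, hf⟩
  · have hf' := orthonormal_toLp_iff.1 hf
    refine not_memSchatten_of_tsum_eq_top hp
      -- The operator sees its argument through the Fourier transform, so this test function
      -- isolates the m-th term.
      (f := fun m : ℕ => 𝓕⁻ (conjS (tfShift ((m : ℝ) • ν₁) ((m : ℝ) • ν₂) f)))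
      (orthonormal_toLp_fourier_iff.1 ?_) hg ?_
    · simp_rw [FourierTransform.fourier_fourierInv_eq]
      exact orthonormal_toLp_conjS hf
    · rw [← tsum_enorm_decayCoeff_rpow hp]
      refine tsum_congr fun m => ?_
      congr 2
      refine (hA _ _).unique ?_
      simp_rw [FourierTransform.fourier_fourierInv_eq, hg', hf']
      convert hasSum_ite_eq m (decayCoeff (1 / p) m) using 2 with k
      by_cases h : m = k
      · simp [h]
      · simp [h, Ne.symm h]
  · refine not_memSchatten_of_not_summable (𝓕⁻ (conjS f)) hg fun hsum =>
      not_summable_one_add_inv (hsum.congr fun m => ?_)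
    have : A (𝓕⁻ (conjS f)) (conjS (tfShift ((m : ℝ) • μ₁) ((m : ℝ) • μ₂) g))
        = decayCoeff (1 / 2) m := by
      refine (hA _ _).unique ?_
      simp_rw [FourierTransform.fourier_fourierInv_eq, hg', hf]
      convert hasSum_ite_eq m (decayCoeff (1 / 2) m) using 2 with k
      by_cases h : m = k
      · simp [h]
      · simp [h, Ne.symm h]
    rw [this, ← Real.rpow_two, norm_decayCoeff_rpow two_pos]

theorem IsCritical.mem_Icc {d : ℕ} {p α : ℝ} (hp : 1 ≤ p) {ν₁ ν₂ : RR d} {f : 𝓢(RR d, ℂ)}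
    (h : IsCritical p α ν₁ ν₂ f) : 0 ≤ α ∧ α ≤ 1 := by
  rcases h with ⟨rfl, -⟩ | ⟨rfl, -⟩
  · exact ⟨by positivity, (div_le_one (by linarith)).2 hp⟩
  · norm_num

/-- Otherwise the first two members coincide. The conclusion makes the ray nontrivial, so that the
series converges. -/
theorem ne_zero_or_ne_zero_of_orthonormal {d : ℕ} {x ξ : RR d} {g : 𝓢(RR d, ℂ)}
    (hg : Orthonormal ℂ fun k : ℕ => (tfShift ((k : ℝ) • x) ((k : ℝ) • ξ) g).toLp 2 volume) :
    x ≠ 0 ∨ ξ ≠ 0 := by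
  by_contra! h
  have h1 := hg.inner_eq_zero zero_ne_one
  have h2 := hg.1 0
  simp only [h.1, h.2, smul_zero, inner_self_eq_zero] at h1 h2
  simp [h1] at h2

theorem exists_symbol_mem_not_memSchatten {d : ℕ} {p α s : ℝ} (hp : 1 ≤ p) (hs : s ≤ 0)
    {P : Fin ((d + d) + (d + d)) → ℝ≥0∞} (hP : ∀ i, 1 ≤ P i)
    {c : Equiv.Perm (Fin ((d + d) + (d + d)))} {μ₁ μ₂ ν₁ ν₂ : RR d} (hμν : ⟪μ₁, ν₁⟫ = 0)
    {g f : 𝓢(RR d, ℂ)}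
    (hg : Orthonormal ℂ fun k : ℕ =>
      (tfShift ((k : ℝ) • μ₁) ((k : ℝ) • μ₂) g).toLp 2 volume)
    (hf : IsCritical p α ν₁ ν₂ f) {z : Fin ((d + d) + (d + d)) → ℝ}
    (hz : z = phasePoint (joinPts μ₁ ν₁) (joinPts (μ₂ - ν₁) (ν₂ - μ₁)))
    {j : Fin ((d + d) + (d + d))} (hj : |z j| = 1) (hle : ∀ i, |z i| ≤ 1)
    (hlt : ∀ i, i ≠ j → z i ≠ 0 → c i < c j)
    (hPj : P (c j) ≠ ⊤ → 1 < (α - s) * (P (c j)).toReal) :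
    ∃ τ : 𝓢'(RR (d + d), ℂ),
      (∀ φ : 𝓢(RR (d + d), ℂ), φ ≠ 0 → τ ∈ mixedModulationSpace φ c (polyWeight s) P) ∧
      ¬ MemSchatten p (pseudodiffOp τ) := by
  obtain ⟨hα0, hα1⟩ := hf.mem_Icc hp
  obtain ⟨τ, hτ, hτs⟩ := exists_symbol_of_series (norm_decayCoeff_le_one hα0)
    (ne_zero_or_ne_zero_of_orthonormal hg) hμν g f
  subst hz
  exact ⟨τ, fun φ _ => mem_mixedModulationSpace_of_isWeakSeries hα0 hα1 hs
    (fun k => (norm_decayCoeff α k).le) hτs P hP c hj hle hlt hPj φ,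
    not_memSchatten_of_series (by linarith) hτ hg hf⟩

theorem exists_kernel_mem_not_memSchatten {d : ℕ} {p α s : ℝ} (hp : 1 ≤ p) (hs : s ≤ 0)
    {P : Fin ((d + d) + (d + d)) → ℝ≥0∞} (hP : ∀ i, 1 ≤ P i)
    {c : Equiv.Perm (Fin ((d + d) + (d + d)))} {μ₁ μ₂ ν₁ ν₂ : RR d} (hμν : ⟪μ₁, ν₁⟫ = 0)
    (hν : ⟪ν₁, ν₂⟫ = 0) {g f : 𝓢(RR d, ℂ)}
    (hg : Orthonormal ℂ fun k : ℕ =>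
      (tfShift ((k : ℝ) • μ₁) ((k : ℝ) • μ₂) g).toLp 2 volume)
    (hf : IsCritical p α ν₁ ν₂ f) {z : Fin ((d + d) + (d + d)) → ℝ}
    (hz : z = phasePoint (joinPts μ₁ ν₂) (joinPts μ₂ (-ν₁)))
    {j : Fin ((d + d) + (d + d))} (hj : |z j| = 1) (hle : ∀ i, |z i| ≤ 1)
    (hlt : ∀ i, i ≠ j → z i ≠ 0 → c i < c j)
    (hPj : P (c j) ≠ ⊤ → 1 < (α - s) * (P (c j)).toReal) :
    ∃ τ κ : 𝓢'(RR (d + d), ℂ), HasKernel (pseudodiffOp τ) κ ∧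
      (∀ φ : 𝓢(RR (d + d), ℂ), φ ≠ 0 → κ ∈ mixedModulationSpace φ c (polyWeight s) P) ∧
      ¬ MemSchatten p (pseudodiffOp τ) := by
  obtain ⟨hα0, hα1⟩ := hf.mem_Icc hp
  have hμ := ne_zero_or_ne_zero_of_orthonormal hg
  obtain ⟨τ, hτ, -⟩ := exists_symbol_of_series (norm_decayCoeff_le_one hα0) hμ hμν g f
  obtain ⟨κ, hκ, hκs⟩ := exists_kernel_of_series (norm_decayCoeff_le_one hα0) hμ hν hτ
  subst hz
  exact ⟨τ, κ, hκ, fun φ _ => mem_mixedModulationSpace_of_isWeakSeries hα0 hα1 hs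
    (fun k => (norm_decayCoeff α k).le) hκs P hP c hj hle hlt hPj φ,
    not_memSchatten_of_series (by linarith) hτ hg hf⟩

/-! ### Critical families and the exponent condition -/

theorem isCritical_zero_of_norm_eq_one {d : ℕ} (p : ℝ) {f : 𝓢(RR d, ℂ)}
    (hf : ∫ t, f t * conjS f t = 1) : IsCritical p (1 / 2) 0 0 f := by
  refine Or.inr ⟨rfl, fun k => ?_⟩
  have : tfShift ((k : ℝ) • (0 : RR d)) ((k : ℝ) • (0 : RR d)) f = f := by
    ext t
    simp [tfShift_apply, phase]
  rw [this, hf]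

theorem exists_isCritical_zero {d : ℕ} (p : ℝ) (i : Fin d) :
    ∃ f : 𝓢(RR d, ℂ), IsCritical p (1 / 2) 0 0 f := by
  obtain ⟨b, hb⟩ := exists_orthonormal_translations i
  have := orthonormal_toLp_iff.1 hb 0 0
  exact ⟨_, isCritical_zero_of_norm_eq_one p (by simpa using this)⟩

theorem exists_isCritical_translations {d : ℕ} (p : ℝ) (i : Fin d) :
    ∃ f : 𝓢(RR d, ℂ), IsCritical p (1 / p) (EuclideanSpace.single i 1) 0 f := by
  obtain ⟨b, hb⟩ := exists_orthonormal_translations i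
  exact ⟨b, Or.inl ⟨rfl, by simpa only [smul_zero] using hb⟩⟩

theorem exists_isCritical_modulations {d : ℕ} (p : ℝ) (i : Fin d) :
    ∃ f : 𝓢(RR d, ℂ), IsCritical p (1 / p) 0 (EuclideanSpace.single i 1) f := by
  obtain ⟨b, hb⟩ := exists_orthonormal_modulations i
  exact ⟨b, Or.inl ⟨rfl, by simpa only [smul_zero] using hb⟩⟩

/-- At s = 0 and q = r the product is exactly 1; either strict inequality pushes it above. -/
theorem one_lt_one_div_sub_mul_toReal {r s : ℝ} (hr : 0 < r) (hs : s ≤ 0) {q : ℝ≥0∞}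
    (hq : ENNReal.ofReal r ≤ q) (h : s < 0 ∨ ENNReal.ofReal r < q) (hq' : q ≠ ⊤) :
    1 < (1 / r - s) * q.toReal := by
  have hle : r ≤ q.toReal := (ENNReal.ofReal_le_iff_le_toReal hq').1 hq
  have e : (1 / r) * r = 1 := one_div_mul_cancel hr.ne'
  have hr' : 0 < 1 / r := by positivity
  rcases h with h | h
  · nlinarith
  · have hlt : r < q.toReal := (ENNReal.ofReal_lt_iff_lt_toReal hr.le hq').1 h
    nlinarith

theorem abs_single_le_one {d : ℕ} (i k : Fin d) :
    |(EuclideanSpace.single i (1 : ℝ) : RR d) k| ≤ 1 := by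
  rw [PiLp.single_apply]
  split_ifs <;> simp

theorem abs_phasePoint_joinPts_le_one {d : ℕ} {u v w z : RR d} (hu : ∀ k, |u k| ≤ 1)
    (hv : ∀ k, |v k| ≤ 1) (hw : ∀ k, |w k| ≤ 1) (hz : ∀ k, |z k| ≤ 1) :
    ∀ j, |phasePoint (joinPts u v) (joinPts w z) j| ≤ 1 :=
  forall_phaseIndex (fun k => by rw [phasePoint_timeFst]; exact hu k)
    (fun k => by rw [phasePoint_timeSnd]; exact hv k)
    (fun k => by rw [phasePoint_freqFst]; exact hw k)
    (fun k => by rw [phasePoint_freqSnd]; exact hz k)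

/-! ### Choice of rays -/

section

variable {d : ℕ} {p s : ℝ} {P : Fin ((d + d) + (d + d)) → ℝ≥0∞}
  {c : Equiv.Perm (Fin ((d + d) + (d + d)))}

/-- With ν₁ = ν₂ = 0 the ray lies on a single coordinate axis of the first factor, in time or in
frequency. -/
theorem exists_kernel_of_val_lt (hp : 1 ≤ p) (hs : s ≤ 0) (hP : ∀ i, 1 ≤ P i)
    (hc : IsSlicePermutation c) {j : Fin ((d + d) + (d + d))} (hj : (c j).val < 2 * d)
    (hPj : P (c j) ≠ ⊤ → 1 < (1 / 2 - s) * (P (c j)).toReal) :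
    ∃ τ κ : 𝓢'(RR (d + d), ℂ), HasKernel (pseudodiffOp τ) κ ∧
      (∀ φ : 𝓢(RR (d + d), ℂ), φ ≠ 0 → κ ∈ mixedModulationSpace φ c (polyWeight s) P) ∧
      ¬ MemSchatten p (pseudodiffOp τ) := by
  induction j using forall_phaseIndex with
  | h₁ i =>
    obtain ⟨g, hg⟩ := exists_orthonormal_translations i
    obtain ⟨f, hf⟩ := exists_isCritical_zero p i
    refine exists_kernel_mem_not_memSchatten hp hs hP (μ₂ := 0) (inner_zero_right _) (inner_zero_right _)
      (by simpa only [smul_zero] using hg) hf rfl ?_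
      (abs_phasePoint_joinPts_le_one ?_ ?_ ?_ ?_) ?_ hPj
    · rw [phasePoint_timeFst]
      simp
    · simpa using abs_single_le_one i
    · simp
    · simp
    · simp
    · refine forall_phaseIndex ?_ ?_ ?_ ?_ <;> intro k hk h
      · have : k ≠ i := fun h => hk (by rw [h])
        rw [phasePoint_timeFst] at h
        simp [this] at h
      · rw [phasePoint_timeSnd] at h
        simp at h
      · rw [phasePoint_freqFst] at h
        simp at h
      · rw [phasePoint_freqSnd] at h
        simp at h
  | h₂ i => exact absurd hj (hc.le_timeSnd i).not_gt
  | h₃ i =>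
    obtain ⟨g, hg⟩ := exists_orthonormal_modulations i
    obtain ⟨f, hf⟩ := exists_isCritical_zero p i
    refine exists_kernel_mem_not_memSchatten hp hs hP (μ₁ := 0) (inner_zero_left _) (inner_zero_right _)
      (by simpa only [smul_zero] using hg) hf rfl ?_
      (abs_phasePoint_joinPts_le_one ?_ ?_ ?_ ?_) ?_ hPj
    · rw [phasePoint_freqFst]
      simp
    · simp
    · simp
    · simpa using abs_single_le_one i
    · simp
    · refine forall_phaseIndex ?_ ?_ ?_ ?_ <;> intro k hk h
      · rw [phasePoint_timeFst] at h
        simp at h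
      · rw [phasePoint_timeSnd] at h
        simp at h
      · have : k ≠ i := fun h => hk (by rw [h])
        rw [phasePoint_freqFst] at h
        simp [this] at h
      · rw [phasePoint_freqSnd] at h
        simp at h
  | h₄ i => exact absurd hj (hc.le_freqSnd i).not_gt

/-- Orthonormal f_k are obtained from ν₂ = e_i (time) or ν₁ = e_i (frequency). The orthonormal g_k
add one coordinate of the first factor to the ray. -/
theorem exists_kernel_of_le_val (hp : 1 ≤ p) (hs : s ≤ 0) (hP : ∀ i, 1 ≤ P i)
    (hc : IsSlicePermutation c) {j : Fin ((d + d) + (d + d))} (hj : 2 * d ≤ (c j).val)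
    (hPj : P (c j) ≠ ⊤ → 1 < (1 / p - s) * (P (c j)).toReal) :
    ∃ τ κ : 𝓢'(RR (d + d), ℂ), HasKernel (pseudodiffOp τ) κ ∧
      (∀ φ : 𝓢(RR (d + d), ℂ), φ ≠ 0 → κ ∈ mixedModulationSpace φ c (polyWeight s) P) ∧
      ¬ MemSchatten p (pseudodiffOp τ) := by
  induction j using forall_phaseIndex with
  | h₁ i => exact absurd hj (hc.timeFst_lt i).not_ge
  | h₂ i =>
    obtain ⟨g, hg⟩ := exists_orthonormal_translations i
    obtain ⟨f, hf⟩ := exists_isCritical_modulations p i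
    refine exists_kernel_mem_not_memSchatten hp hs hP (μ₂ := 0) (inner_zero_right _) (inner_zero_left _)
      (by simpa only [smul_zero] using hg) hf rfl ?_
      (abs_phasePoint_joinPts_le_one ?_ ?_ ?_ ?_) ?_ hPj
    · rw [phasePoint_timeSnd]
      simp
    · simpa using abs_single_le_one i
    · simpa using abs_single_le_one i
    · simp
    · simp
    · refine forall_phaseIndex ?_ ?_ ?_ ?_ <;> intro k hk h
      -- The slice property puts the extra coordinate earlier in the order of integration.
      · exact Fin.lt_def.2 ((hc.timeFst_lt k).trans_le (hc.le_timeSnd i))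
      · have : k ≠ i := fun h => hk (by rw [h])
        rw [phasePoint_timeSnd] at h
        simp [this] at h
      · rw [phasePoint_freqFst] at h
        simp at h
      · rw [phasePoint_freqSnd] at h
        simp at h
  | h₃ i => exact absurd hj (hc.freqFst_lt i).not_ge
  | h₄ i =>
    obtain ⟨g, hg⟩ := exists_orthonormal_modulations i
    obtain ⟨f, hf⟩ := exists_isCritical_translations p i
    refine exists_kernel_mem_not_memSchatten hp hs hP (μ₁ := 0) (inner_zero_left _) (inner_zero_right _)
      (by simpa only [smul_zero] using hg) hf rfl ?_
      (abs_phasePoint_joinPts_le_one ?_ ?_ ?_ ?_) ?_ hPj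
    · rw [phasePoint_freqSnd]
      simp
    · simp
    · simp
    · simpa using abs_single_le_one i
    · simpa using abs_single_le_one i
    · refine forall_phaseIndex ?_ ?_ ?_ ?_ <;> intro k hk h
      · rw [phasePoint_timeFst] at h
        simp at h
      · rw [phasePoint_timeSnd] at h
        simp at h
      · exact Fin.lt_def.2 ((hc.freqFst_lt k).trans_le (hc.le_freqSnd i))
      · have : k ≠ i := fun h => hk (by rw [h])
        rw [phasePoint_freqSnd] at h
        simp [this] at h

/-- With μ₁ = ν₂ = e_i the frequency component ν₂ - μ₁ vanishes: both families are orthonormal, yet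
the ray is a single time axis. -/
theorem exists_symbol_of_timeFst (hp : 1 ≤ p) (hs : s ≤ 0) (hP : ∀ i, 1 ≤ P i) (i : Fin d)
    (hPj : P (c (timeFst i)) ≠ ⊤ → 1 < (1 / p - s) * (P (c (timeFst i))).toReal) :
    ∃ τ : 𝓢'(RR (d + d), ℂ),
      (∀ φ : 𝓢(RR (d + d), ℂ), φ ≠ 0 → τ ∈ mixedModulationSpace φ c (polyWeight s) P) ∧
      ¬ MemSchatten p (pseudodiffOp τ) := by
  obtain ⟨g, hg⟩ := exists_orthonormal_translations i
  obtain ⟨f, hf⟩ := exists_isCritical_modulations p i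
  refine exists_symbol_mem_not_memSchatten hp hs hP (μ₂ := 0) (inner_zero_right _)
    (by simpa only [smul_zero] using hg) hf rfl ?_
    (abs_phasePoint_joinPts_le_one ?_ ?_ ?_ ?_) ?_ hPj
  · rw [phasePoint_timeFst]
    simp
  · simpa using abs_single_le_one i
  · simp
  · simp
  · simp
  · refine forall_phaseIndex ?_ ?_ ?_ ?_ <;> intro k hk h
    · have : k ≠ i := fun h => hk (by rw [h])
      rw [phasePoint_timeFst] at h
      simp [this] at h
    · rw [phasePoint_timeSnd] at h
      simp at h
    · rw [phasePoint_freqFst] at h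
      simp at h
    · rw [phasePoint_freqSnd] at h
      simp at h

theorem exists_symbol_of_freqFst (hp : 1 ≤ p) (hs : s ≤ 0) (hP : ∀ i, 1 ≤ P i) (i : Fin d)
    (hPj : P (c (freqFst i)) ≠ ⊤ → 1 < (1 / 2 - s) * (P (c (freqFst i))).toReal) :
    ∃ τ : 𝓢'(RR (d + d), ℂ),
      (∀ φ : 𝓢(RR (d + d), ℂ), φ ≠ 0 → τ ∈ mixedModulationSpace φ c (polyWeight s) P) ∧
      ¬ MemSchatten p (pseudodiffOp τ) := by
  obtain ⟨g, hg⟩ := exists_orthonormal_modulations i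
  obtain ⟨f, hf⟩ := exists_isCritical_zero p i
  refine exists_symbol_mem_not_memSchatten hp hs hP (μ₁ := 0) (inner_zero_left _)
    (by simpa only [smul_zero] using hg) hf rfl ?_
    (abs_phasePoint_joinPts_le_one ?_ ?_ ?_ ?_) ?_ hPj
  · rw [phasePoint_freqFst]
    simp
  · simp
  · simp
  · simpa using abs_single_le_one i
  · simp
  · refine forall_phaseIndex ?_ ?_ ?_ ?_ <;> intro k hk h
    · rw [phasePoint_timeFst] at h
      simp at h
    · rw [phasePoint_timeSnd] at h
      simp at h
    · have : k ≠ i := fun h => hk (by rw [h])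
      rw [phasePoint_freqFst] at h
      simp [this] at h
    · rw [phasePoint_freqSnd] at h
      simp at h

/-- For a time coordinate μ₂ = ν₁ = e_i cancel in μ₂ - ν₁, leaving one axis. For a frequency
coordinate μ₂ = ν₂ = e_i also leaves an inner coordinate, integrated earlier. -/
theorem exists_symbol_of_le_val (hp : 1 ≤ p) (hs : s ≤ 0) (hP : ∀ i, 1 ≤ P i)
    (hc : IsSlicePermutation c) {j : Fin ((d + d) + (d + d))} (hj : 2 * d ≤ (c j).val)
    (hPj : P (c j) ≠ ⊤ → 1 < (1 / p - s) * (P (c j)).toReal) :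
    ∃ τ : 𝓢'(RR (d + d), ℂ),
      (∀ φ : 𝓢(RR (d + d), ℂ), φ ≠ 0 → τ ∈ mixedModulationSpace φ c (polyWeight s) P) ∧
      ¬ MemSchatten p (pseudodiffOp τ) := by
  induction j using forall_phaseIndex with
  | h₁ i => exact absurd hj (hc.timeFst_lt i).not_ge
  | h₂ i =>
    obtain ⟨g, hg⟩ := exists_orthonormal_modulations i
    obtain ⟨f, hf⟩ := exists_isCritical_translations p i
    refine exists_symbol_mem_not_memSchatten hp hs hP (μ₁ := 0) (inner_zero_left _)
      (by simpa only [smul_zero] using hg) hf rfl ?_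
      (abs_phasePoint_joinPts_le_one ?_ ?_ ?_ ?_) ?_ hPj
    · rw [phasePoint_timeSnd]
      simp
    · simp
    · simpa using abs_single_le_one i
    · simp
    · simp
    · refine forall_phaseIndex ?_ ?_ ?_ ?_ <;> intro k hk h
      · rw [phasePoint_timeFst] at h
        simp at h
      · have : k ≠ i := fun h => hk (by rw [h])
        rw [phasePoint_timeSnd] at h
        simp [this] at h
      · rw [phasePoint_freqFst] at h
        simp at h
      · rw [phasePoint_freqSnd] at h
        simp at h
  | h₃ i => exact absurd hj (hc.freqFst_lt i).not_ge
  | h₄ i =>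
    obtain ⟨g, hg⟩ := exists_orthonormal_modulations i
    obtain ⟨f, hf⟩ := exists_isCritical_modulations p i
    refine exists_symbol_mem_not_memSchatten hp hs hP (μ₁ := 0) (inner_zero_left _)
      (by simpa only [smul_zero] using hg) hf rfl ?_
      (abs_phasePoint_joinPts_le_one ?_ ?_ ?_ ?_) ?_ hPj
    · rw [phasePoint_freqSnd]
      simp
    · simp
    · simp
    · simpa using abs_single_le_one i
    · simpa using abs_single_le_one i
    · refine forall_phaseIndex ?_ ?_ ?_ ?_ <;> intro k hk h
      · rw [phasePoint_timeFst] at h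
        simp at h
      · rw [phasePoint_timeSnd] at h
        simp at h
      · exact Fin.lt_def.2 ((hc.freqFst_lt k).trans_le (hc.le_freqSnd i))
      · have : k ≠ i := fun h => hk (by rw [h])
        rw [phasePoint_freqSnd] at h
        simp [this] at h

end

end MixedModulation

end

/-! ### The theorem -/

theorem theorem5p4 (d : ℕ) (hd : 0 < d) (p : ℝ) (hp1 : 1 ≤ p) (hp2 : p ≤ 2)
    (s : ℝ) (hs : s ≤ 0)
    (P : Fin ((d + d) + (d + d)) → ℝ≥0∞)
    (hP1 : ∀ j, j.val < 2 * d → 2 ≤ P j)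
    (hP2 : ∀ j, 2 * d ≤ j.val → ENNReal.ofReal p ≤ P j)
    (c : Equiv.Perm (Fin ((d + d) + (d + d))))
    (hc : MixedModulation.IsSlicePermutation c)
    (hlarger : s < 0 ∨ (∃ j, j.val < 2 * d ∧ 2 < P j) ∨
      (∃ j, 2 * d ≤ j.val ∧ ENNReal.ofReal p < P j)) :
    (∃ τ k : 𝓢'(MixedModulation.RR (d + d), ℂ),
      MixedModulation.HasKernel (MixedModulation.pseudodiffOp τ) k ∧
      (∀ φ : 𝓢(MixedModulation.RR (d + d), ℂ), φ ≠ 0 →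
        k ∈ MixedModulation.mixedModulationSpace φ c (MixedModulation.polyWeight s) P) ∧
      ¬ MixedModulation.MemSchatten p (MixedModulation.pseudodiffOp τ)) ∧
    (∃ τ : 𝓢'(MixedModulation.RR (d + d), ℂ),
      (∀ φ : 𝓢(MixedModulation.RR (d + d), ℂ), φ ≠ 0 →
        τ ∈ MixedModulation.mixedModulationSpace φ c (MixedModulation.polyWeight s) P) ∧
      ¬ MixedModulation.MemSchatten p (MixedModulation.pseudodiffOp τ)) := by
  have hP : ∀ i, 1 ≤ P i := fun i => by
    rcases lt_or_ge i.val (2 * d) with h | h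
    · exact one_le_two.trans (hP1 i h)
    · exact (ENNReal.one_le_ofReal.2 hp1).trans (hP2 i h)
  have hp0 : 0 < p := zero_lt_one.trans_le hp1
  have two : ENNReal.ofReal 2 = 2 := ENNReal.ofReal_ofNat 2
  let i₀ : Fin d := ⟨0, hd⟩
  have hi₀ := hc.timeFst_lt i₀
  have hinner : ∀ j, j.val < 2 * d → (s < 0 ∨ 2 < P j) → P j ≠ ⊤ →
      1 < (1 / 2 - s) * (P j).toReal := fun j hj h =>
    MixedModulation.one_lt_one_div_sub_mul_toReal two_pos hs (two.trans_le (hP1 j hj))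
      (by rwa [two])
  have houter : ∀ j, 2 * d ≤ j.val → ENNReal.ofReal p < P j → P j ≠ ⊤ →
      1 < (1 / p - s) * (P j).toReal := fun j hj h =>
    MixedModulation.one_lt_one_div_sub_mul_toReal hp0 hs (hP2 j hj) (Or.inr h)
  constructor
  · rcases hlarger with h | ⟨j, hj, h⟩ | ⟨j, hj, h⟩
    · exact MixedModulation.exists_kernel_of_val_lt hp1 hs hP hc hi₀ (hinner _ hi₀ (Or.inl h))
    -- Exponents are indexed by position in the iterated integral; pulling back along c gives the
    -- phase-space coordinate.
    · obtain ⟨j, rfl⟩ := c.surjective j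
      exact MixedModulation.exists_kernel_of_val_lt hp1 hs hP hc hj (hinner _ hj (Or.inr h))
    · obtain ⟨j, rfl⟩ := c.surjective j
      exact MixedModulation.exists_kernel_of_le_val hp1 hs hP hc hj (houter _ hj h)
  · have htime : ∀ i : Fin d, (s < 0 ∨ ENNReal.ofReal p < P (c (MixedModulation.timeFst i))) →
        ∃ τ : 𝓢'(MixedModulation.RR (d + d), ℂ),
          (∀ φ : 𝓢(MixedModulation.RR (d + d), ℂ), φ ≠ 0 →
            τ ∈ MixedModulation.mixedModulationSpace φ c (MixedModulation.polyWeight s) P) ∧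
          ¬ MixedModulation.MemSchatten p (MixedModulation.pseudodiffOp τ) := fun i h =>
      MixedModulation.exists_symbol_of_timeFst hp1 hs hP i
        (MixedModulation.one_lt_one_div_sub_mul_toReal hp0 hs
          (((ENNReal.ofReal_le_ofReal hp2).trans_eq two).trans (hP1 _ (hc.timeFst_lt i))) h)
    -- For p < 2 the inner exponents, being at least 2, already exceed p, so the cancelling ray
    -- works whichever alternative holds.
    rcases hp2.lt_or_eq with hlt | rfl
    · refine htime i₀ (Or.inr (lt_of_lt_of_le ?_ (hP1 _ hi₀)))
      rw [← two]
      exact (ENNReal.ofReal_lt_ofReal_iff two_pos).2 hlt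
    · rcases hlarger with h | ⟨j, hj, h⟩ | ⟨j, hj, h⟩
      · exact htime i₀ (Or.inl h)
      · obtain ⟨j, rfl⟩ := c.surjective j
        induction j using MixedModulation.forall_phaseIndex with
        | h₁ i => exact htime i (Or.inr (by rwa [two]))
        | h₂ i => exact absurd hj (hc.le_timeSnd i).not_gt
        | h₃ i =>
          exact MixedModulation.exists_symbol_of_freqFst hp1 hs hP i (hinner _ hj (Or.inr h))
        | h₄ i => exact absurd hj (hc.le_freqSnd i).not_gt
      · obtain ⟨j, rfl⟩ := c.surjective j
        exact MixedModulation.exists_symbol_of_le_val hp1 hs hP hc hj (houter _ hj h)
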